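/- **Theorem 3.6.** Let $q,r\in\mathcal S(\mathbb R)$ be complex-valued Schwartz functions, and put $$\mu=\int_{-\infty}^{\infty}q\,r\,dy,\qquad E(x)=\exp\Big(\tfrac i2\int_{-\infty}^x q\,r\,dy\Big),\qquad \tilde q=E^2q,\quad \tilde r=E^{-2}r,$$ $$u=q,\quad v=-\tfrac i2 r'-\tfrac14 q r^2,\qquad p=\tfrac i2 q'-\tfrac14 q^2r,\quad s=r .$$ Let $\lambda=\zeta^2$, and consider on $\mathbb R$ the four linear systems $$(1.1)\ \ \Psi'=\begin{bmatrix}-i\zeta^2-\tfrac i2 qr&\zeta q\\ \zeta r&i\zeta^2+\tfrac i2qr\end{bmatrix}\Psi,\qquad (1.7)\ \ \Psi'=\begin{bmatrix}-i\zeta^2&\zeta\tilde q\\ \zeta\tilde r&i\zeta^2\end{bmatrix}\Psi,$$ $$(1.11)\ \ \Psi'=\begin{bmatrix}-i\lambda&u\\ v&i\lambda\end{bmatrix}\Psi,\qquad (1.12)\ \ \Psi'=\begin{bmatrix}-i\lambda&p\\ s&i\lambda\end{bmatrix}\Psi .$$ For each of them the Jost solutions are the solutions with $\psi_1=o(1),\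 \psi_2=e^{i\lambda x}[1+o(1)]$ and $\bar\psi_1=e^{-i\lambda x}[1+o(1)],\ \bar\psi_2=o(1)$ as $x\to+\infty$, and $\phi_1=e^{-i\lambda x}[1+o(1)],\ \phi_2=o(1)$ and $\bar\phi_1=o(1),\ \bar\phi_2=e^{i\lambda x}[1+o(1)]$ as $x\to-\infty$ (a bar is not complex conjugation), and the scattering coefficients are defined by the limits $$\tfrac1T=\lim_{x\to+\infty}e^{i\lambda x}\phi_1=\lim_{x\to-\infty}e^{-i\lambda x}\psi_2,\qquad \tfrac1{\bar T}=\lim_{x\to+\infty}e^{-i\lambda x}\bar\phi_2=\lim_{x\to-\infty}e^{i\lambda x}\bar\psi_1,$$ $$\tfrac RT=\lim_{x\to+\infty}e^{-i\lambda x}\phi_2,\quad \tfrac LT=\lim_{x\to-\infty}e^{i\lambda x}\psi_1,\quad \tfrac{\bar R}{\bar T}=\lim_{x\to+\infty}e^{i\lambda x}\bar\phi_1,\quad \tfrac{\bar L}{\bar T}=\lim_{x\to-\infty}e^{-i\lambda x}\bar\psi_2 .$$ Coefficients of (1.7), (1.11), (1.12) carry the superscripts $(\tilde q,\tilde r)$,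 $(u,v)$, $(p,s)$; those of (1.1) carry none. For all four systems, $\psi,\phi$ and the limits for $1/T$ exist, with $\psi,\phi$ unique, for $\lambda\in\overline{\mathbb C^+}$; the same holds for $\bar\psi,\bar\phi$ and $1/\bar T$ for $\lambda\in\overline{\mathbb C^-}$; and the other four limits exist for $\lambda\in\mathbb R$. Let $\Sigma$ (resp. $\bar\Sigma$) be the set of $\lambda\in\mathbb R$ at which $1/T(\zeta)=0$ (resp. $1/\bar T(\zeta)=0$) for (1.1), so that $T,R,L$ (resp. $\bar T,\bar R,\bar L$) do not exist there. Then $0\notin\Sigma\cup\bar\Sigma$ and the following hold. (a) For every $\zeta\in\mathbb C$ with $\lambda=\zeta^2$ in the indicated set (wherever the coefficients exist; the transmission coefficients of the four systems are infinite simultaneously), $$T(\zeta)=e^{i\mu/2}\,T^{(\tilde q,\tilde r)}(\zeta)=T^{(u,v)}(\lambda)=T^{(p,s)}(\lambda),\qquad\lambda\in\overline{\mathbb C^+},$$ $$\bar T(\zeta)=e^{-i\mu/2}\,\bar T^{(\tilde q,\tilde r)}(\zeta)=\bar T^{(u,v)}(\lambda)=\bar T^{(p,s)}(\lambda),\qquad\lambda\in\overline{\mathbb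 C^-},$$ and for $\lambda\in\mathbb R$ $$\zeta R(\zeta)=\zeta e^{i\mu}R^{(\tilde q,\tilde r)}(\zeta)=R^{(u,v)}(\lambda)=\lambda R^{(p,s)}(\lambda),$$ $$\zeta\bar R(\zeta)=\zeta e^{-i\mu}\bar R^{(\tilde q,\tilde r)}(\zeta)=\lambda\bar R^{(u,v)}(\lambda)=\bar R^{(p,s)}(\lambda),$$ $$\zeta L(\zeta)=\zeta L^{(\tilde q,\tilde r)}(\zeta)=\lambda L^{(u,v)}(\lambda)=L^{(p,s)}(\lambda),$$ $$\zeta\bar L(\zeta)=\zeta\bar L^{(\tilde q,\tilde r)}(\zeta)=\bar L^{(u,v)}(\lambda)=\lambda\bar L^{(p,s)}(\lambda).$$ (b) $T(\zeta)$ is even in $\zeta$, hence a function of $\lambda$ (take $\zeta=\sqrt\lambda$, principal branch). As such it is meromorphic in $\mathbb C^+$ and continuous in $\overline{\mathbb C^+}$ except at its poles in $\mathbb C^+$ and at the points of $\Sigma$. (c) $\bar T(\zeta)$ is even in $\zeta$, hence a function of $\lambda$. As such it is meromorphic in $\mathbb C^-$ and continuous in $\overline{\mathbb C^-}$ except at its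 poles in $\mathbb C^-$ and at the points of $\bar\Sigma$. (d) $R(\zeta)/\zeta,\ \bar R(\zeta)/\zeta,\ L(\zeta)/\zeta,\ \bar L(\zeta)/\zeta$ are even in $\zeta$, hence functions of $\lambda\in\mathbb R$, $\lambda\ne0$. They extend to $\lambda=0$ so that $R/\zeta$ and $L/\zeta$ are continuous on $\mathbb R\setminus\Sigma$, and $\bar R/\zeta$ and $\bar L/\zeta$ are continuous on $\mathbb R\setminus\bar\Sigma$. In particular, if $\Sigma=\bar\Sigma=\emptyset$, there are no exceptional real points in (b)-(d). -/

import Mathlib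

open Complex Filter Topology MeasureTheory
open scoped SchwartzMap Matrix

noncomputable section

namespace Scattering

/-! Linear systems `f' = A(x) f` on the line, where `A` tends to `diag(-i lam, i lam)` at `±∞`. -/

/-- `f` is a (classical, column-vector) solution of `f' = A(x) f` on the whole line. -/
def IsSolution (A : ℝ → Matrix (Fin 2) (Fin 2) ℂ) (f : ℝ → Fin 2 → ℂ) : Prop :=
  ∀ x : ℝ, HasDerivAt f (A x *ᵥ f x) x

/-- The Jost solution `ψ`: `ψ₁ = o(1)`, `ψ₂ = e^{i lam x}[1 + o(1)]` as `x → +∞`. -/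
structure IsJostPsi (A : ℝ → Matrix (Fin 2) (Fin 2) ℂ) (lam : ℂ) (f : ℝ → Fin 2 → ℂ) : Prop where
  sol : IsSolution A f
  fst : Tendsto (fun x : ℝ => f x 0) atTop (𝓝 0)
  snd : Tendsto (fun x : ℝ => exp (-(I * lam * x)) * f x 1) atTop (𝓝 1)

/-- The Jost solution `ψ̄`: `ψ̄₁ = e^{-i lam x}[1 + o(1)]`, `ψ̄₂ = o(1)` as `x → +∞`. -/
structure IsJostPsiBar (A : ℝ → Matrix (Fin 2) (Fin 2) ℂ) (lam : ℂ) (f : ℝ → Fin 2 → ℂ) :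
    Prop where
  sol : IsSolution A f
  fst : Tendsto (fun x : ℝ => exp (I * lam * x) * f x 0) atTop (𝓝 1)
  snd : Tendsto (fun x : ℝ => f x 1) atTop (𝓝 0)

/-- The Jost solution `φ`: `φ₁ = e^{-i lam x}[1 + o(1)]`, `φ₂ = o(1)` as `x → -∞`. -/
structure IsJostPhi (A : ℝ → Matrix (Fin 2) (Fin 2) ℂ) (lam : ℂ) (f : ℝ → Fin 2 → ℂ) : Prop where
  sol : IsSolution A f
  fst : Tendsto (fun x : ℝ => exp (I * lam * x) * f x 0) atBot (𝓝 1)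
  snd : Tendsto (fun x : ℝ => f x 1) atBot (𝓝 0)

/-- The Jost solution `φ̄`: `φ̄₁ = o(1)`, `φ̄₂ = e^{i lam x}[1 + o(1)]` as `x → -∞`. -/
structure IsJostPhiBar (A : ℝ → Matrix (Fin 2) (Fin 2) ℂ) (lam : ℂ) (f : ℝ → Fin 2 → ℂ) :
    Prop where
  sol : IsSolution A f
  fst : Tendsto (fun x : ℝ => f x 0) atBot (𝓝 0)
  snd : Tendsto (fun x : ℝ => exp (-(I * lam * x)) * f x 1) atBot (𝓝 1)

/-- The Jost solution `ψ` (an arbitrary function if there is none). -/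
def psi (A : ℝ → Matrix (Fin 2) (Fin 2) ℂ) (lam : ℂ) : ℝ → Fin 2 → ℂ :=
  Classical.epsilon (IsJostPsi A lam)

/-- The Jost solution `ψ̄` (an arbitrary function if there is none). -/
def psiBar (A : ℝ → Matrix (Fin 2) (Fin 2) ℂ) (lam : ℂ) : ℝ → Fin 2 → ℂ :=
  Classical.epsilon (IsJostPsiBar A lam)

/-- The Jost solution `φ` (an arbitrary function if there is none). -/
def phi (A : ℝ → Matrix (Fin 2) (Fin 2) ℂ) (lam : ℂ) : ℝ → Fin 2 → ℂ :=
  Classical.epsilon (IsJostPhi A lam)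

/-- The Jost solution `φ̄` (an arbitrary function if there is none). -/
def phiBar (A : ℝ → Matrix (Fin 2) (Fin 2) ℂ) (lam : ℂ) : ℝ → Fin 2 → ℂ :=
  Classical.epsilon (IsJostPhiBar A lam)

/-! The coefficients in the spatial asymptotics of the Jost solutions at the opposite end:
`φ ~ ((1/T) e^{-i lam x}, (R/T) e^{i lam x})`, `φ̄ ~ ((R̄/T̄) e^{-i lam x}, (1/T̄) e^{i lam x})`
as `x → +∞`, and `ψ ~ ((L/T) e^{-i lam x}, (1/T) e^{i lam x})`,
`ψ̄ ~ ((1/T̄) e^{-i lam x}, (L̄/T̄) e^{i lam x})` as `x → -∞`. -/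

/-- `1/T`. -/
def oneOverT (A : ℝ → Matrix (Fin 2) (Fin 2) ℂ) (lam : ℂ) : ℂ :=
  limUnder atTop fun x : ℝ => exp (I * lam * x) * phi A lam x 0

/-- `R/T`. -/
def ROverT (A : ℝ → Matrix (Fin 2) (Fin 2) ℂ) (lam : ℂ) : ℂ :=
  limUnder atTop fun x : ℝ => exp (-(I * lam * x)) * phi A lam x 1

/-- `L/T`. -/
def LOverT (A : ℝ → Matrix (Fin 2) (Fin 2) ℂ) (lam : ℂ) : ℂ :=
  limUnder atBot fun x : ℝ => exp (I * lam * x) * psi A lam x 0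

/-- `1/T̄`. -/
def oneOverTBar (A : ℝ → Matrix (Fin 2) (Fin 2) ℂ) (lam : ℂ) : ℂ :=
  limUnder atTop fun x : ℝ => exp (-(I * lam * x)) * phiBar A lam x 1

/-- `R̄/T̄`. -/
def RBarOverTBar (A : ℝ → Matrix (Fin 2) (Fin 2) ℂ) (lam : ℂ) : ℂ :=
  limUnder atTop fun x : ℝ => exp (I * lam * x) * phiBar A lam x 0

/-- `L̄/T̄`. -/
def LBarOverTBar (A : ℝ → Matrix (Fin 2) (Fin 2) ℂ) (lam : ℂ) : ℂ :=
  limUnder atBot fun x : ℝ => exp (-(I * lam * x)) * psiBar A lam x 1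

/-! The six scattering coefficients. Where `1/T = 0` (resp. `1/T̄ = 0`) the value is
conventionally `0`. -/

/-- The transmission coefficient `T`. -/
def T (A : ℝ → Matrix (Fin 2) (Fin 2) ℂ) (lam : ℂ) : ℂ := 1 / oneOverT A lam

/-- The transmission coefficient `T̄`. -/
def TBar (A : ℝ → Matrix (Fin 2) (Fin 2) ℂ) (lam : ℂ) : ℂ := 1 / oneOverTBar A lam

/-- The right reflection coefficient `R`. -/
def R (A : ℝ → Matrix (Fin 2) (Fin 2) ℂ) (lam : ℂ) : ℂ := ROverT A lam * T A lam

/-- The right reflection coefficient `R̄`. -/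
def RBar (A : ℝ → Matrix (Fin 2) (Fin 2) ℂ) (lam : ℂ) : ℂ := RBarOverTBar A lam * TBar A lam

/-- The left reflection coefficient `L`. -/
def L (A : ℝ → Matrix (Fin 2) (Fin 2) ℂ) (lam : ℂ) : ℂ := LOverT A lam * T A lam

/-- The left reflection coefficient `L̄`. -/
def LBar (A : ℝ → Matrix (Fin 2) (Fin 2) ℂ) (lam : ℂ) : ℂ := LBarOverTBar A lam * TBar A lam

/-- `T` is properly defined at `lam`: the Jost solutions `ψ` and `φ` exist and are unique, and the
limits of `ψ` at `-∞` and of `φ` at `+∞` that define `1/T` exist and agree. -/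
structure TDefined (A : ℝ → Matrix (Fin 2) (Fin 2) ℂ) (lam : ℂ) : Prop where
  psi_unique : ∃! f, IsJostPsi A lam f
  phi_unique : ∃! f, IsJostPhi A lam f
  psi_lim : Tendsto (fun x : ℝ => exp (-(I * lam * x)) * psi A lam x 1) atBot (𝓝 (oneOverT A lam))
  phi_lim : Tendsto (fun x : ℝ => exp (I * lam * x) * phi A lam x 0) atTop (𝓝 (oneOverT A lam))

/-- `T̄` is properly defined at `lam`. -/
structure TBarDefined (A : ℝ → Matrix (Fin 2) (Fin 2) ℂ) (lam : ℂ) : Prop where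
  psiBar_unique : ∃! f, IsJostPsiBar A lam f
  phiBar_unique : ∃! f, IsJostPhiBar A lam f
  psiBar_lim : Tendsto (fun x : ℝ => exp (I * lam * x) * psiBar A lam x 0) atBot
    (𝓝 (oneOverTBar A lam))
  phiBar_lim : Tendsto (fun x : ℝ => exp (-(I * lam * x)) * phiBar A lam x 1) atTop
    (𝓝 (oneOverTBar A lam))

/-- The four limits `R/T`, `L/T`, `R̄/T̄`, `L̄/T̄` exist at `lam`. -/
structure ReflectionDefined (A : ℝ → Matrix (Fin 2) (Fin 2) ℂ) (lam : ℂ) : Prop where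
  phi_lim : Tendsto (fun x : ℝ => exp (-(I * lam * x)) * phi A lam x 1) atTop (𝓝 (ROverT A lam))
  psi_lim : Tendsto (fun x : ℝ => exp (I * lam * x) * psi A lam x 0) atBot (𝓝 (LOverT A lam))
  phiBar_lim : Tendsto (fun x : ℝ => exp (I * lam * x) * phiBar A lam x 0) atTop
    (𝓝 (RBarOverTBar A lam))
  psiBar_lim : Tendsto (fun x : ℝ => exp (-(I * lam * x)) * psiBar A lam x 1) atBot
    (𝓝 (LBarOverTBar A lam))

/-! The coefficient matrices of the systems. -/

/-- The energy-dependent (Gerdjikov-Ivanov) system with spectral parameter `ζ`. -/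
def giMatrix (q r : ℝ → ℂ) (ζ : ℂ) (x : ℝ) : Matrix (Fin 2) (Fin 2) ℂ :=
  !![-(I * ζ ^ 2) - I / 2 * (q x * r x), ζ * q x;
     ζ * r x, I * ζ ^ 2 + I / 2 * (q x * r x)]

/-- The Kaup-Newell system with spectral parameter `ζ`. -/
def knMatrix (q r : ℝ → ℂ) (ζ : ℂ) (x : ℝ) : Matrix (Fin 2) (Fin 2) ℂ :=
  !![-(I * ζ ^ 2), ζ * q x; ζ * r x, I * ζ ^ 2]

/-- The AKNS system with spectral parameter `lam`. -/
def aknsMatrix (u v : ℝ → ℂ) (lam : ℂ) (x : ℝ) : Matrix (Fin 2) (Fin 2) ℂ :=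
  !![-(I * lam), u x; v x, I * lam]

/-! The potentials of the related systems. -/

/-- `E(x) = exp((i/2) ∫_{-∞}^x q r)`. -/
def E (q r : ℝ → ℂ) (x : ℝ) : ℂ := exp (I / 2 * ∫ y in Set.Iic x, q y * r y)

/-- `μ = ∫_{-∞}^{∞} q r`. -/
def mu (q r : ℝ → ℂ) : ℂ := ∫ y : ℝ, q y * r y

/-- `q̃ = E² q`. -/
def qTilde (q r : ℝ → ℂ) (x : ℝ) : ℂ := E q r x ^ 2 * q x

/-- `r̃ = E⁻² r`. -/
def rTilde (q r : ℝ → ℂ) (x : ℝ) : ℂ := (E q r x ^ 2)⁻¹ * r x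

/-- `v = -(i/2) r' - q r²/4` (and `u = q`). -/
def vPot (q r : ℝ → ℂ) (x : ℝ) : ℂ := -(I * deriv r x / 2) - q x * r x ^ 2 / 4

/-- `p = (i/2) q' - q² r/4` (and `s = r`). -/
def pPot (q r : ℝ → ℂ) (x : ℝ) : ℂ := I * deriv q x / 2 - q x ^ 2 * r x / 4

/-! `T`, `T̄` and `R/ζ`, ... as functions of `l = ζ²`, through the principal square root. -/

/-- `T(ζ)` as a function of `l`, `ζ = √l`. -/
def Tfun (q r : ℝ → ℂ) (l : ℂ) : ℂ := T (giMatrix q r l.sqrt) l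

/-- `T̄(ζ)` as a function of `l`, `ζ = √l`. -/
def TBarFun (q r : ℝ → ℂ) (l : ℂ) : ℂ := TBar (giMatrix q r l.sqrt) l

/-- The poles of `F` in the set `U`. -/
def polesIn (F : ℂ → ℂ) (U : Set ℂ) : Set ℂ := {l | l ∈ U ∧ meromorphicOrderAt F l < 0}

/-- The real `l` at which `1/T` vanishes, so that `T`, `R`, `L` do not exist. -/
def singT (q r : ℝ → ℂ) : Set ℝ := {l | oneOverT (giMatrix q r (l : ℂ).sqrt) l = 0}

/-- The real `l` at which `1/T̄` vanishes, so that `T̄`, `R̄`, `L̄` do not exist. -/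
def singTBar (q r : ℝ → ℂ) : Set ℝ := {l | oneOverTBar (giMatrix q r (l : ℂ).sqrt) l = 0}

end Scattering

end

noncomputable section

namespace Scattering

/-! Integrals over half-lines and parametric integrals. -/

/-! The four systems are gauge equivalent. Solutions of (1.1) are carried to those of (1.7), (1.11)
and (1.12) by the matrices `diag(E, E⁻¹)`, `[[1, 0], [-(i/2) r, ζ]]` and `[[ζ, (i/2) q], [0, 1]]`
(`isGauge_kn`, `isGauge_uv`, `isGauge_ps`). Each has diagonal limits at `±∞`, so it maps a Jost
solution to a multiple of a Jost solution and multiplies the coefficients by quotients of limiting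
diagonal entries (`IsGauge.coeff_eq`). This is (a). Evenness comes from the constant gauge `diag(1,
-1)`, which changes `ζ` into `-ζ` (`isGauge_neg`).

The last two gauges degenerate at `ζ = 0`, but only one nonzero diagonal limit is needed. Since
`1/T` is the Wronskian of `φ` and `ψ`, it can be computed from either of them (`transCoeff_symm`),
and one of the two always sees the diagonal entry `1`. The reflection coefficients that see the
entry `ζ` are exactly those multiplied by `λ` in (a), so their relations are trivial at `ζ = 0`.

Existence of Jost solutions: writing `f = e^{-κx} m` turns the system into a Volterra equation `m =
e_i + K m` on `(-∞, x]`. With `β(x) = ∫_{-∞}^x ‖B‖`, the operator `K` contracts by `1/2` in the norm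
weighted by `e^{-2β}`, uniformly in `κ` with `Re κ ≤ 0` (`norm_volterra_le`). The end `+∞` follows
by `x ↦ -x`. Uniqueness follows from constancy of the Wronskian (`IsJost.eq_strongJost`).

Regularity in `λ` is read off the AKNS systems: their potentials do not involve `λ`, so `1/T` is
continuous on the closed half-plane and holomorphic inside, and the numerators of the reflection
coefficients are continuous on the real line. Taking quotients gives (b) and (c). For (d), the
extensions are the AKNS coefficients themselves: `R/ζ = R^{(p,s)}`, `R̄/ζ = R̄^{(u,v)}`, `L/ζ =
L^{(u,v)}`, `L̄/ζ = L̄^{(p,s)}`. Finally `0 ∉ Σ ∪ Σ̄` because at `ζ = 0` the Kaup-Newell matrix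
vanishes and its `1/T` and `1/T̄` equal `1`. -/

theorem hasDerivAt_setIntegral_Iic {F : Type*} [NormedAddCommGroup F] [NormedSpace ℝ F]
    [CompleteSpace F] {g : ℝ → F} (hc : Continuous g)
    (hi : ∀ x, IntegrableOn g (Set.Iic x)) (x : ℝ) :
    HasDerivAt (fun x => ∫ y in Set.Iic x, g y) (g x) x := by
  have h : (fun x => ∫ y in Set.Iic x, g y) =
      fun x => (∫ y in Set.Iic 0, g y) + ∫ y in (0 : ℝ)..x, g y := by
    funext x
    rw [← intervalIntegral.integral_Iic_sub_Iic (hi 0) (hi x)]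
    abel
  rw [h]
  exact (hc.integral_hasStrictDerivAt 0 x).hasDerivAt.const_add _

theorem tendsto_setIntegral_Iic_atTop {F : Type*} [NormedAddCommGroup F] [NormedSpace ℝ F]
    {g : ℝ → F} (hi : Integrable g) :
    Tendsto (fun x => ∫ y in Set.Iic x, g y) atTop (𝓝 (∫ y, g y)) :=
  (aecover_Iic tendsto_id).integral_tendsto_of_countably_generated hi

/-- A bound on `F` alone suffices: by Cauchy's estimate on circles of radius `δ/2`, which stay in
`U` when centred in the ball of radius `δ/2`, the derivative is dominated by `bound / (δ/2)`. -/
theorem differentiableOn_integral_of_dominated {α : Type*} [MeasurableSpace α] {μ : Measure α}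
    {F : ℂ → α → ℂ} {U : Set ℂ} (hU : IsOpen U) {bound : α → ℝ}
    (hm : ∀ z ∈ U, AEStronglyMeasurable (F z) μ)
    (hb : ∀ᵐ a ∂μ, ∀ z ∈ U, ‖F z a‖ ≤ bound a) (hbi : Integrable bound μ)
    (hd : ∀ a, DifferentiableOn ℂ (fun z => F z a) U) :
    DifferentiableOn ℂ (fun z => ∫ a, F z a ∂μ) U := by
  intro z₀ hz₀
  obtain ⟨δ, hδ, hball⟩ := Metric.isOpen_iff.1 hU z₀ hz₀
  have hε : 0 < δ / 2 := by positivity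
  have hsub : ∀ z ∈ Metric.ball z₀ (δ / 2), Metric.closedBall z (δ / 2) ⊆ U := fun z hz =>
    (Metric.closedBall_subset_ball' (by
      have := Metric.mem_ball.1 hz
      linarith)).trans hball
  have hder : ∀ a, ∀ z ∈ Metric.ball z₀ (δ / 2),
      HasDerivAt (fun z => F z a) (deriv (fun z => F z a) z) z := fun a z hz =>
    ((hd a).differentiableAt (hU.mem_nhds
      (hsub z hz (Metric.mem_closedBall_self hε.le)))).hasDerivAt
  have hz₀b : z₀ ∈ Metric.ball z₀ (δ / 2) := Metric.mem_ball_self hε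
  have hFint : Integrable (F z₀) μ :=
    hbi.mono' (hm z₀ hz₀) (hb.mono fun a ha => ha z₀ hz₀)
  refine (hasDerivAt_integral_of_dominated_loc_of_deriv_le (μ := μ)
    (bound := fun a => bound a / (δ / 2)) (F' := fun z a => deriv (fun z => F z a) z)
    (Metric.ball_mem_nhds z₀ hε) ?_ hFint ?_ ?_ (hbi.div_const _)
    (Eventually.of_forall fun a z hz => hder a z hz)).2.differentiableAt.differentiableWithinAt
  · filter_upwards [hU.mem_nhds hz₀] with z hz using hm z hz
  -- The derivative at `z₀` is measurable in `a` as the limit of difference quotients along a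
  -- sequence of increments; these are at most `δ/2`, so the points remain in `U`.
  · have ht : Tendsto (fun n : ℕ => (((δ / 2) * (1 / ((n : ℝ) + 1)) : ℝ) : ℂ)) atTop (𝓝[≠] 0) := by
      rw [tendsto_nhdsWithin_iff]
      constructor
      · have := (tendsto_one_div_add_atTop_nhds_zero_nat (𝕜 := ℝ)).const_mul (δ / 2)
        rw [mul_zero] at this
        exact_mod_cast (continuous_ofReal.tendsto 0).comp this
      · refine Eventually.of_forall fun n => ?_
        have : (0 : ℝ) < (δ / 2) * (1 / ((n : ℝ) + 1)) := by positivity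
        exact ofReal_ne_zero.2 this.ne'
    refine aestronglyMeasurable_of_tendsto_ae atTop (fun n => ?_)
      (Eventually.of_forall fun a =>
        (hasDerivAt_iff_tendsto_slope_zero.1 (hder a z₀ hz₀b)).comp ht)
    refine AEStronglyMeasurable.const_smul (𝕜 := ℂ) (f := fun a => F _ a - F z₀ a)
      ((hm _ ?_).sub (hm z₀ hz₀)) _
    refine hsub z₀ hz₀b ?_
    have h1 : 1 / ((n : ℝ) + 1) ≤ 1 := by
      rw [div_le_one (by positivity)]
      linarith [n.cast_nonneg (α := ℝ)]
    have h2 : 0 ≤ 1 / ((n : ℝ) + 1) := by positivity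
    rw [Metric.mem_closedBall, dist_eq_norm, add_sub_cancel_left, norm_real, Real.norm_eq_abs,
      abs_of_nonneg (by positivity)]
    nlinarith
  · filter_upwards [hb] with a ha z hz
    refine norm_deriv_le_of_forall_mem_sphere_norm_le hε ?_ fun w hw =>
      ha w (hsub z hz (Metric.sphere_subset_closedBall hw))
    refine DifferentiableOn.diffContOnCl ?_
    rw [closure_ball z hε.ne']
    exact (hd a).mono (hsub z hz)

/-! Linear systems `m' = W m + B m`, normalised at `-∞`, through their Volterra equations. -/

/-- The sum of the norms of the entries. -/
def entryNorm (M : Matrix (Fin 2) (Fin 2) ℂ) : ℝ := ∑ k, ∑ l, ‖M k l‖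

theorem entryNorm_nonneg (M : Matrix (Fin 2) (Fin 2) ℂ) : 0 ≤ entryNorm M :=
  Finset.sum_nonneg fun _ _ => Finset.sum_nonneg fun _ _ => norm_nonneg _

theorem norm_mulVec_le (M : Matrix (Fin 2) (Fin 2) ℂ) (v : Fin 2 → ℂ) (k : Fin 2) :
    ‖(M *ᵥ v) k‖ ≤ entryNorm M * ‖v‖ := by
  calc ‖(M *ᵥ v) k‖ ≤ ∑ l, ‖M k l * v l‖ := norm_sum_le Finset.univ fun l => M k l * v l
    _ ≤ ∑ l, ‖M k l‖ * ‖v‖ := Finset.sum_le_sum fun l _ => by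
        rw [norm_mul]
        exact mul_le_mul_of_nonneg_left (norm_le_pi_norm v l) (norm_nonneg _)
    _ = (∑ l, ‖M k l‖) * ‖v‖ := by rw [Finset.sum_mul]
    _ ≤ entryNorm M * ‖v‖ := by
        refine mul_le_mul_of_nonneg_right ?_ (norm_nonneg _)
        exact Finset.single_le_sum (f := fun k => ∑ l, ‖M k l‖)
          (fun _ _ => Finset.sum_nonneg fun _ _ => norm_nonneg _) (Finset.mem_univ k)

/-- The entries of `B` are continuous and integrable. -/
structure IntegrableEntries (B : ℝ → Matrix (Fin 2) (Fin 2) ℂ) : Prop where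
  cont : ∀ k l, Continuous fun x => B x k l
  int : ∀ k l, Integrable fun x => B x k l

namespace IntegrableEntries

variable {B : ℝ → Matrix (Fin 2) (Fin 2) ℂ}

theorem continuous_entryNorm (hB : IntegrableEntries B) : Continuous fun x => entryNorm (B x) :=
  continuous_finsetSum _ fun k _ => continuous_finsetSum _ fun l _ => (hB.cont k l).norm

theorem integrable_entryNorm (hB : IntegrableEntries B) : Integrable fun x => entryNorm (B x) :=
  integrable_finsetSum _ fun k _ => integrable_finsetSum _ fun l _ => (hB.int k l).norm

theorem continuous_mulVec (hB : IntegrableEntries B) {g : ℝ → Fin 2 → ℂ} (hg : Continuous g)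
    (k : Fin 2) : Continuous fun x => (B x *ᵥ g x) k := by
  simp only [Matrix.mulVec, dotProduct]
  exact continuous_finsetSum _ fun l _ => (hB.cont k l).mul ((continuous_apply l).comp hg)

end IntegrableEntries

/-- `β(x) = ∫_{-∞}^x ‖B‖`. -/
def accNorm (B : ℝ → Matrix (Fin 2) (Fin 2) ℂ) (x : ℝ) : ℝ := ∫ y in Set.Iic x, entryNorm (B y)

theorem accNorm_nonneg (B : ℝ → Matrix (Fin 2) (Fin 2) ℂ) (x : ℝ) : 0 ≤ accNorm B x :=
  setIntegral_nonneg measurableSet_Iic fun _ _ => entryNorm_nonneg _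

theorem accNorm_le {B : ℝ → Matrix (Fin 2) (Fin 2) ℂ} (hB : IntegrableEntries B) (x : ℝ) :
    accNorm B x ≤ ∫ y, entryNorm (B y) :=
  setIntegral_le_integral hB.integrable_entryNorm (Eventually.of_forall fun _ => entryNorm_nonneg _)

theorem hasDerivAt_accNorm {B : ℝ → Matrix (Fin 2) (Fin 2) ℂ} (hB : IntegrableEntries B) (x : ℝ) :
    HasDerivAt (accNorm B) (entryNorm (B x)) x :=
  hasDerivAt_setIntegral_Iic hB.continuous_entryNorm
    (fun _ => hB.integrable_entryNorm.integrableOn) x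

theorem integrable_entryNorm_mul_exp {B : ℝ → Matrix (Fin 2) (Fin 2) ℂ}
    (hB : IntegrableEntries B) :
    Integrable fun y => entryNorm (B y) * Real.exp (2 * accNorm B y) := by
  have hc : Continuous (accNorm B) :=
    continuous_iff_continuousAt.2 fun x => (hasDerivAt_accNorm hB x).continuousAt
  refine (hB.integrable_entryNorm.mul_const (Real.exp (2 * ∫ y, entryNorm (B y)))).mono'
    (hB.continuous_entryNorm.mul (Real.continuous_exp.comp
      (hc.const_mul 2))).aestronglyMeasurable (Eventually.of_forall fun y => ?_)
  rw [Real.norm_of_nonneg (mul_nonneg (entryNorm_nonneg _) (Real.exp_pos _).le)]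
  refine mul_le_mul_of_nonneg_left (Real.exp_le_exp.2 ?_) (entryNorm_nonneg _)
  linarith [accNorm_le hB y]

/-- The integrand is the derivative of `e^{2β}/2`. The factor `2` in the exponent is what produces
the contraction constant `1/2`. -/
theorem setIntegral_entryNorm_mul_exp {B : ℝ → Matrix (Fin 2) (Fin 2) ℂ}
    (hB : IntegrableEntries B) (x : ℝ) :
    ∫ y in Set.Iic x, entryNorm (B y) * Real.exp (2 * accNorm B y) =
      (Real.exp (2 * accNorm B x) - 1) / 2 := by
  have hlim : Tendsto (accNorm B) atBot (𝓝 0) := tendsto_integral_Iic_zero tendsto_id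
  have hd : ∀ y ∈ Set.Iic x, HasDerivAt (fun y => Real.exp (2 * accNorm B y) / 2)
      (entryNorm (B y) * Real.exp (2 * accNorm B y)) y := fun y _ => by
    convert! (((hasDerivAt_accNorm hB y).const_mul 2).exp).div_const 2 using 1
    ring
  have h := integral_Iic_of_hasDerivAt_of_tendsto' (m := 1 / 2) hd
    (integrable_entryNorm_mul_exp hB).integrableOn
    (by simpa using ((Real.continuous_exp.tendsto _).comp (hlim.const_mul 2)).div_const 2)
  rw [h]
  ring

/-- The exponents of the Volterra kernel. -/
def weight (i : Fin 2) (κ : ℂ) (k : Fin 2) : ℂ := if k = i then 0 else 2 * κ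

theorem weight_re_nonpos {κ : ℂ} (hκ : κ.re ≤ 0) (i k : Fin 2) : (weight i κ k).re ≤ 0 := by
  unfold weight
  split_ifs
  · simp
  · simpa using mul_nonpos_of_nonneg_of_nonpos zero_le_two hκ

theorem norm_kernel_le {w : ℂ} (hw : w.re ≤ 0) {x y : ℝ} (hy : y ≤ x) :
    ‖exp (w * (x - y))‖ ≤ 1 := by
  rw [← ofReal_sub, norm_exp, re_mul_ofReal]
  exact Real.exp_le_one_iff.2 (mul_nonpos_of_nonpos_of_nonneg hw (sub_nonneg.2 hy))

/-- The Volterra operator. -/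
def volterra (B : ℝ → Matrix (Fin 2) (Fin 2) ℂ) (i : Fin 2) (κ : ℂ) (g : ℝ → Fin 2 → ℂ)
    (x : ℝ) (k : Fin 2) : ℂ :=
  ∫ y in Set.Iic x, exp (weight i κ k * (x - y)) * (B y *ᵥ g y) k

/-! ### Bounds, differentiability and parameter dependence of the Volterra operator -/

section volterra

variable {B : ℝ → Matrix (Fin 2) (Fin 2) ℂ} {i : Fin 2} {κ : ℂ} {g : ℝ → Fin 2 → ℂ}

theorem norm_volterra_integrand_le (hκ : κ.re ≤ 0) {x y : ℝ} (hy : y ≤ x) (k : Fin 2) {c : ℝ}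
    (hg : ‖g y‖ ≤ c) :
    ‖exp (weight i κ k * (x - y)) * (B y *ᵥ g y) k‖ ≤ entryNorm (B y) * c := by
  rw [norm_mul]
  calc _ ≤ 1 * (entryNorm (B y) * ‖g y‖) :=
        mul_le_mul (norm_kernel_le (weight_re_nonpos hκ i k) hy) (norm_mulVec_le _ _ _)
          (norm_nonneg _) zero_le_one
    _ ≤ entryNorm (B y) * c := by
        rw [one_mul]
        exact mul_le_mul_of_nonneg_left hg (entryNorm_nonneg _)

theorem continuous_volterra_integrand (hB : IntegrableEntries B) (hg : Continuous g) (x : ℝ)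
    (k : Fin 2) : Continuous fun y : ℝ => exp (weight i κ k * (x - y)) * (B y *ᵥ g y) k :=
  (by fun_prop : Continuous fun y : ℝ => exp (weight i κ k * (x - y))).mul
    (hB.continuous_mulVec hg k)

theorem integrableOn_volterra_integrand (hB : IntegrableEntries B) (hκ : κ.re ≤ 0)
    (hg : Continuous g) {C : ℝ} (hgC : ∀ y, ‖g y‖ ≤ C) (x : ℝ) (k : Fin 2) :
    IntegrableOn (fun y : ℝ => exp (weight i κ k * (x - y)) * (B y *ᵥ g y) k) (Set.Iic x) := by
  refine (hB.integrable_entryNorm.mul_const C).integrableOn.mono'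
    (continuous_volterra_integrand hB hg x k).aestronglyMeasurable ?_
  filter_upwards [ae_restrict_mem measurableSet_Iic] with y hy
  exact norm_volterra_integrand_le hκ hy k (hgC y)

/-- In the norm weighted by `e^{-2β}` the operator has norm at most `1/2`. The `-1` is kept because
it lets the bound `e^{2β}` survive the addition of `e_i`. -/
theorem norm_volterra_le (hB : IntegrableEntries B) (hκ : κ.re ≤ 0)
    {c : ℝ} (hc : 0 ≤ c) (hg : ∀ y, ‖g y‖ ≤ c * Real.exp (2 * accNorm B y)) (x : ℝ) :
    ‖volterra B i κ g x‖ ≤ c * ((Real.exp (2 * accNorm B x) - 1) / 2) := by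
  have h1 : 1 ≤ Real.exp (2 * accNorm B x) :=
    Real.one_le_exp (mul_nonneg zero_le_two (accNorm_nonneg B x))
  refine (pi_norm_le_iff_of_nonneg (mul_nonneg hc (by linarith))).2 fun k => ?_
  rw [← setIntegral_entryNorm_mul_exp hB x, ← integral_const_mul]
  refine norm_integral_le_of_norm_le
    ((integrable_entryNorm_mul_exp hB).const_mul c).integrableOn ?_
  filter_upwards [ae_restrict_mem measurableSet_Iic] with y hy
  exact (norm_volterra_integrand_le hκ hy k (hg y)).trans (le_of_eq (by ring))

/-- The kernel factors as `e^{wx} e^{-wy}`, so `x` leaves the integrand and the product rule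
applies. -/
theorem hasDerivAt_volterra (hB : IntegrableEntries B) (hκ : κ.re ≤ 0)
    (hg : Continuous g) {C : ℝ} (hgC : ∀ y, ‖g y‖ ≤ C) (x : ℝ) (k : Fin 2) :
    HasDerivAt (fun x => volterra B i κ g x k)
      (weight i κ k * volterra B i κ g x k + (B x *ᵥ g x) k) x := by
  set w := weight i κ k with hw
  have hsplit : ∀ x y : ℝ, exp (w * (x - y)) * (B y *ᵥ g y) k =
      exp (w * x) * (exp (-(w * y)) * (B y *ᵥ g y) k) := fun x y => by
    rw [← mul_assoc, ← exp_add]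
    ring_nf
  have hfac : (fun x => volterra B i κ g x k) = fun x : ℝ =>
      exp (w * x) * ∫ y in Set.Iic x, exp (-(w * y)) * (B y *ᵥ g y) k := by
    funext x
    unfold volterra
    rw [← integral_const_mul]
    exact integral_congr_ae (Eventually.of_forall fun y => hsplit x y)
  -- Up to the constant `e^{-wx}` this is the integrand with the full kernel, which is bounded on
  -- `(-∞, x]`.
  have hint : ∀ x : ℝ, IntegrableOn (fun y : ℝ => exp (-(w * y)) * (B y *ᵥ g y) k)
      (Set.Iic x) := fun x => by
    refine ((integrableOn_volterra_integrand (i := i) hB hκ hg hgC x k).const_mul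
      (exp (-(w * x)))).congr (Eventually.of_forall fun y => ?_)
    change exp (-(w * x)) * (exp (w * (x - y)) * _) = _
    rw [hsplit, ← mul_assoc, ← exp_add]
    simp
  have hcont : Continuous fun y : ℝ => exp (-(w * y)) * (B y *ᵥ g y) k :=
    (by fun_prop : Continuous fun y : ℝ => exp (-(w * y))).mul (hB.continuous_mulVec hg k)
  have hexp : HasDerivAt (fun x : ℝ => exp (w * x)) (w * exp (w * x)) x := by
    convert! ((ofRealCLM.hasDerivAt (x := x)).const_mul w).cexp using 1
    simp [mul_comm]
  have h := hexp.mul (hasDerivAt_setIntegral_Iic hcont hint x)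
  have hvx := congrFun hfac x
  rw [hfac, hvx]
  convert! h using 1
  rw [← mul_assoc (exp (w * x)) (exp (-(w * x))), ← exp_add, add_neg_cancel, exp_zero]
  ring

theorem tendsto_volterra_atBot (hB : IntegrableEntries B) (hκ : κ.re ≤ 0)
    {C : ℝ} (hgC : ∀ y, ‖g y‖ ≤ C) :
    Tendsto (volterra B i κ g) atBot (𝓝 0) := by
  have hC : 0 ≤ C := (norm_nonneg _).trans (hgC 0)
  have hlim : Tendsto (accNorm B) atBot (𝓝 0) := tendsto_integral_Iic_zero tendsto_id
  refine squeeze_zero_norm (fun x => ?_) (by simpa using hlim.mul_const C)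
  refine (pi_norm_le_iff_of_nonneg (mul_nonneg (accNorm_nonneg B x) hC)).2 fun k => ?_
  rw [accNorm, ← integral_mul_const]
  refine norm_integral_le_of_norm_le (hB.integrable_entryNorm.mul_const C).integrableOn ?_
  filter_upwards [ae_restrict_mem measurableSet_Iic] with y hy
  exact norm_volterra_integrand_le hκ hy k (hgC y)

/-- The argument `G κ` may vary with `κ` because the Picard iterates do; the common bound `C`
provides a dominating function independent of `κ`. -/
theorem continuousOn_volterra (hB : IntegrableEntries B) {G : ℂ → ℝ → Fin 2 → ℂ} {C : ℝ}
    (hG : ∀ κ : ℂ, κ.re ≤ 0 → Continuous (G κ)) (hGC : ∀ κ : ℂ, κ.re ≤ 0 → ∀ y, ‖G κ y‖ ≤ C)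
    (hGκ : ∀ y k, ContinuousOn (fun κ => G κ y k) {κ | κ.re ≤ 0}) (x : ℝ) (k : Fin 2) :
    ContinuousOn (fun κ => volterra B i κ (G κ) x k) {κ | κ.re ≤ 0} := by
  refine continuousOn_of_dominated (bound := fun y => entryNorm (B y) * C)
    (fun κ hκ => (continuous_volterra_integrand hB (hG κ hκ) x k).aestronglyMeasurable)
    (fun κ hκ => ?_) (hB.integrable_entryNorm.mul_const C).integrableOn
    (Eventually.of_forall fun y => ?_)
  · filter_upwards [ae_restrict_mem measurableSet_Iic] with y hy
    exact norm_volterra_integrand_le hκ hy k (hGC κ hκ y)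
  · simp only [Matrix.mulVec, dotProduct]
    refine ContinuousOn.mul (Continuous.continuousOn ?_)
      (continuousOn_finsetSum _ fun l _ => continuousOn_const.mul (hGκ y l))
    unfold weight
    split_ifs <;> fun_prop

theorem differentiableOn_volterra (hB : IntegrableEntries B) {G : ℂ → ℝ → Fin 2 → ℂ} {C : ℝ}
    (hG : ∀ κ : ℂ, κ.re ≤ 0 → Continuous (G κ)) (hGC : ∀ κ : ℂ, κ.re ≤ 0 → ∀ y, ‖G κ y‖ ≤ C)
    (hGκ : ∀ y k, DifferentiableOn ℂ (fun κ => G κ y k) {κ | κ.re < 0}) (x : ℝ) (k : Fin 2) :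
    DifferentiableOn ℂ (fun κ => volterra B i κ (G κ) x k) {κ | κ.re < 0} := by
  refine differentiableOn_integral_of_dominated (bound := fun y => entryNorm (B y) * C)
    (isOpen_lt continuous_re continuous_const)
    (fun κ hκ => (continuous_volterra_integrand hB (hG κ (le_of_lt hκ)) x k).aestronglyMeasurable)
    ?_ (hB.integrable_entryNorm.mul_const C).integrableOn (fun y => ?_)
  · filter_upwards [ae_restrict_mem measurableSet_Iic] with y hy κ hκ
    exact norm_volterra_integrand_le (le_of_lt hκ) hy k (hGC κ (le_of_lt hκ) y)
  · simp only [Matrix.mulVec, dotProduct]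
    refine DifferentiableOn.mul (Differentiable.differentiableOn ?_)
      (DifferentiableOn.fun_sum fun l _ => (hGκ y l).const_mul _)
    unfold weight
    split_ifs <;> fun_prop

end volterra

/-- The Picard iterates of the Volterra equation `m = e_i + K m`. -/
def picard (B : ℝ → Matrix (Fin 2) (Fin 2) ℂ) (i : Fin 2) : ℕ → ℂ → ℝ → Fin 2 → ℂ
  | 0 => fun _ _ => Pi.single i 1
  | n + 1 => fun κ x => Pi.single i 1 + volterra B i κ (picard B i n κ) x

/-- The solution of the Volterra equation `m = e_i + K m`. -/
def jostFactor (B : ℝ → Matrix (Fin 2) (Fin 2) ℂ) (i : Fin 2) (κ : ℂ) (x : ℝ) : Fin 2 → ℂ :=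
  limUnder atTop fun n => picard B i n κ x

/-- A bound for the solution of the Volterra equation. -/
def expBound (B : ℝ → Matrix (Fin 2) (Fin 2) ℂ) : ℝ := Real.exp (2 * ∫ y, entryNorm (B y))

/-- `1 + ∫ (B m)_i`, the limit of `m_i` at `+∞`. -/
def transFactor (B : ℝ → Matrix (Fin 2) (Fin 2) ℂ) (i : Fin 2) (κ : ℂ) : ℂ :=
  1 + ∫ y, (B y *ᵥ jostFactor B i κ y) i

/-- `∫ e^{-2κy} (B m)_j dy`, the limit of `e^{-2κx} m_j` at `+∞`. -/
def reflFactor (B : ℝ → Matrix (Fin 2) (Fin 2) ℂ) (i j : Fin 2) (κ : ℂ) : ℂ :=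
  ∫ y : ℝ, exp (-(2 * κ * y)) * (B y *ᵥ jostFactor B i κ y) j

theorem norm_single_le (i : Fin 2) : ‖(Pi.single i 1 : Fin 2 → ℂ)‖ ≤ 1 :=
  (pi_norm_le_iff_of_nonneg zero_le_one).2 fun k => by
    rw [Pi.single_apply]
    split_ifs <;> simp

/-! ### Convergence of the Picard iterates; asymptotics of the limit and its dependence on `κ` -/

section

variable {B : ℝ → Matrix (Fin 2) (Fin 2) ℂ} {i j : Fin 2} {κ : ℂ}

theorem exp_accNorm_le (hB : IntegrableEntries B) (x : ℝ) :
    Real.exp (2 * accNorm B x) ≤ expBound B :=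
  Real.exp_le_exp.2 (by linarith [accNorm_le hB x])

theorem one_le_exp_accNorm (x : ℝ) : 1 ≤ Real.exp (2 * accNorm B x) :=
  Real.one_le_exp (mul_nonneg zero_le_two (accNorm_nonneg B x))

/-- The induction closes because `1 + (e^{2β} - 1)/2 ≤ e^{2β}` when `β ≥ 0`. -/
theorem norm_picard_le (hB : IntegrableEntries B) (hκ : κ.re ≤ 0) (n : ℕ) (x : ℝ) :
    ‖picard B i n κ x‖ ≤ Real.exp (2 * accNorm B x) := by
  induction n generalizing x with
  | zero => exact (norm_single_le i).trans (one_le_exp_accNorm x)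
  | succ n ih =>
    have h := norm_volterra_le (i := i) hB hκ zero_le_one
      (fun y => (ih y).trans_eq (one_mul _).symm) x
    refine (norm_add_le _ _).trans ?_
    linarith [norm_single_le i, one_le_exp_accNorm (B := B) x]

theorem norm_picard_le_expBound (hB : IntegrableEntries B) (hκ : κ.re ≤ 0) (n : ℕ) (x : ℝ) :
    ‖picard B i n κ x‖ ≤ expBound B :=
  (norm_picard_le hB hκ n x).trans (exp_accNorm_le hB x)

theorem continuous_volterra {g : ℝ → Fin 2 → ℂ} (hB : IntegrableEntries B) (hκ : κ.re ≤ 0)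
    (hg : Continuous g) {C : ℝ} (hgC : ∀ y, ‖g y‖ ≤ C) : Continuous (volterra B i κ g) :=
  continuous_pi fun k => continuous_iff_continuousAt.2 fun x =>
    (hasDerivAt_volterra hB hκ hg hgC x k).continuousAt

theorem continuous_picard (hB : IntegrableEntries B) (hκ : κ.re ≤ 0) (n : ℕ) :
    Continuous (picard B i n κ) := by
  induction n with
  | zero => exact continuous_const
  | succ n ih =>
    exact continuous_const.add (continuous_volterra hB hκ ih (norm_picard_le_expBound hB hκ n))

theorem volterra_sub {g h : ℝ → Fin 2 → ℂ} (hB : IntegrableEntries B) (hκ : κ.re ≤ 0)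
    (hg : Continuous g) (hh : Continuous h) {C : ℝ} (hgC : ∀ y, ‖g y‖ ≤ C)
    (hhC : ∀ y, ‖h y‖ ≤ C) (x : ℝ) :
    volterra B i κ g x - volterra B i κ h x = volterra B i κ (g - h) x := by
  funext k
  simp only [volterra, Pi.sub_apply]
  rw [← integral_sub (integrableOn_volterra_integrand hB hκ hg hgC x k)
    (integrableOn_volterra_integrand hB hκ hh hhC x k)]
  refine integral_congr_ae (Eventually.of_forall fun y => ?_)
  simp only [Matrix.mulVec_sub, Pi.sub_apply]
  ring

theorem norm_picard_succ_sub_le (hB : IntegrableEntries B) (hκ : κ.re ≤ 0) (n : ℕ) (x : ℝ) :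
    ‖picard B i (n + 1) κ x - picard B i n κ x‖ ≤ (1 / 2) ^ n * Real.exp (2 * accNorm B x) := by
  induction n generalizing x with
  | zero =>
    have h := norm_volterra_le (i := i) hB hκ zero_le_one
      (fun y => (norm_picard_le (i := i) hB hκ 0 y).trans_eq (one_mul _).symm) x
    change ‖Pi.single i 1 + volterra B i κ (picard B i 0 κ) x - Pi.single i 1‖ ≤ _
    rw [add_sub_cancel_left]
    refine h.trans ?_
    linarith [one_le_exp_accNorm (B := B) x]
  | succ n ih =>
    change ‖Pi.single i 1 + volterra B i κ (picard B i (n + 1) κ) x -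
      (Pi.single i 1 + volterra B i κ (picard B i n κ) x)‖ ≤ _
    rw [add_sub_add_left_eq_sub, volterra_sub hB hκ (continuous_picard hB hκ _)
      (continuous_picard hB hκ _) (norm_picard_le_expBound hB hκ _)
      (norm_picard_le_expBound hB hκ _)]
    refine (norm_volterra_le hB hκ (by positivity) ih x).trans ?_
    rw [pow_succ, mul_assoc]
    refine mul_le_mul_of_nonneg_left ?_ (by positivity)
    linarith

/-- The right-hand side depends on neither `x` nor `κ`: convergence is uniform in both, which passes
continuity in `x` and `κ` and holomorphy in `κ` to the limit. -/
theorem dist_picard_succ_le (hB : IntegrableEntries B) (hκ : κ.re ≤ 0) (x : ℝ) (n : ℕ) :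
    dist (picard B i n κ x) (picard B i (n + 1) κ x) ≤ expBound B * (1 / 2) ^ n := by
  rw [dist_comm, dist_eq_norm, mul_comm]
  exact (norm_picard_succ_sub_le hB hκ n x).trans
    (mul_le_mul_of_nonneg_left (exp_accNorm_le hB x) (by positivity))

theorem tendsto_picard (hB : IntegrableEntries B) (hκ : κ.re ≤ 0) (x : ℝ) :
    Tendsto (fun n => picard B i n κ x) atTop (𝓝 (jostFactor B i κ x)) :=
  (cauchySeq_of_le_geometric _ _ one_half_lt_one
    (dist_picard_succ_le hB hκ x)).tendsto_limUnder

theorem dist_picard_jostFactor_le (hB : IntegrableEntries B) (hκ : κ.re ≤ 0) (x : ℝ) (n : ℕ) :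
    dist (picard B i n κ x) (jostFactor B i κ x) ≤ expBound B * (1 / 2) ^ n / (1 - 1 / 2) :=
  dist_le_of_le_geometric_of_tendsto _ _ one_half_lt_one
    (dist_picard_succ_le hB hκ x) (tendsto_picard hB hκ x) n

theorem norm_jostFactor_le (hB : IntegrableEntries B) (hκ : κ.re ≤ 0) (x : ℝ) :
    ‖jostFactor B i κ x‖ ≤ expBound B :=
  le_of_tendsto (tendsto_picard hB hκ x).norm
    (Eventually.of_forall fun n => norm_picard_le_expBound hB hκ n x)

theorem exists_dist_picard_lt (B : ℝ → Matrix (Fin 2) (Fin 2) ℂ) {ε : ℝ} (hε : 0 < ε) :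
    ∀ᶠ n : ℕ in atTop, expBound B * (1 / 2) ^ n / (1 - 1 / 2) < ε := by
  have h := ((tendsto_pow_atTop_nhds_zero_of_lt_one (r := (1 / 2 : ℝ)) (by norm_num)
    one_half_lt_one).const_mul (expBound B)).div_const (1 - 1 / 2)
  rw [mul_zero, zero_div] at h
  exact h.eventually_lt_const hε

theorem continuous_jostFactor (hB : IntegrableEntries B) (hκ : κ.re ≤ 0) :
    Continuous (jostFactor B i κ) := by
  refine TendstoUniformly.continuous (F := fun n x => picard B i n κ x) (p := atTop) ?_
    (Frequently.of_forall fun n => continuous_picard hB hκ n)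
  rw [Metric.tendstoUniformly_iff]
  intro ε hε
  filter_upwards [exists_dist_picard_lt B hε] with n hn x
  rw [dist_comm]
  exact (dist_picard_jostFactor_le hB hκ x n).trans_lt hn

theorem jostFactor_eq (hB : IntegrableEntries B) (hκ : κ.re ≤ 0) (x : ℝ) :
    jostFactor B i κ x = Pi.single i 1 + volterra B i κ (jostFactor B i κ) x := by
  refine tendsto_nhds_unique ((tendsto_add_atTop_iff_nat 1).2 (tendsto_picard hB hκ x))
    (Tendsto.const_add _ (tendsto_pi_nhds.2 fun k => ?_))
  refine tendsto_integral_of_dominated_convergence (fun y => entryNorm (B y) * expBound B)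
    (fun n => (continuous_volterra_integrand hB (continuous_picard hB hκ n)
      x k).aestronglyMeasurable) (hB.integrable_entryNorm.mul_const _).integrableOn
    (fun n => ?_) (Eventually.of_forall fun y => ?_)
  · filter_upwards [ae_restrict_mem measurableSet_Iic] with y hy
    exact norm_volterra_integrand_le hκ hy k (norm_picard_le_expBound hB hκ n y)
  · simp only [Matrix.mulVec, dotProduct]
    exact (tendsto_finsetSum _ fun l _ =>
      ((tendsto_pi_nhds.1 (tendsto_picard hB hκ y) l).const_mul _)).const_mul _

theorem hasDerivAt_jostFactor (hB : IntegrableEntries B) (hκ : κ.re ≤ 0) (x : ℝ) (k : Fin 2) :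
    HasDerivAt (fun x => jostFactor B i κ x k)
      (weight i κ k * jostFactor B i κ x k + (B x *ᵥ jostFactor B i κ x) k) x := by
  have h := (hasDerivAt_volterra (i := i) hB hκ (continuous_jostFactor hB hκ)
    (norm_jostFactor_le (i := i) hB hκ) x k).const_add ((Pi.single i 1 : Fin 2 → ℂ) k)
  -- The weight vanishes at the index `i`, so it annihilates the summand `e_i` of `m = e_i + K m`.
  have hw : weight i κ k * jostFactor B i κ x k =
      weight i κ k * volterra B i κ (jostFactor B i κ) x k := by
    rw [congrFun (jostFactor_eq hB hκ x) k, Pi.add_apply, mul_add, weight, Pi.single_apply]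
    split_ifs <;> simp
  rw [hw]
  exact h.congr_of_eventuallyEq
    (Eventually.of_forall fun x => congrFun (jostFactor_eq hB hκ x) k)

theorem tendsto_jostFactor_atBot (hB : IntegrableEntries B) (hκ : κ.re ≤ 0) :
    Tendsto (jostFactor B i κ) atBot (𝓝 (Pi.single i 1)) := by
  have h := (tendsto_volterra_atBot (i := i) hB hκ
    (norm_jostFactor_le (i := i) hB hκ)).const_add (Pi.single i 1)
  rw [add_zero] at h
  exact h.congr fun x => (jostFactor_eq hB hκ x).symm

theorem integrable_mulVec_jostFactor (hB : IntegrableEntries B) (hκ : κ.re ≤ 0) (k : Fin 2) :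
    Integrable fun y => (B y *ᵥ jostFactor B i κ y) k :=
  (hB.integrable_entryNorm.mul_const (expBound B)).mono'
    (hB.continuous_mulVec (continuous_jostFactor hB hκ) k).aestronglyMeasurable
    (Eventually.of_forall fun y => (norm_mulVec_le _ _ _).trans
      (mul_le_mul_of_nonneg_left (norm_jostFactor_le hB hκ y) (entryNorm_nonneg _)))

/-- For the component `i` the kernel is `1`, so the Volterra equation is a plain integral over `(-∞,
x]`. -/
theorem tendsto_jostFactor_atTop (hB : IntegrableEntries B) (hκ : κ.re ≤ 0) :
    Tendsto (fun x => jostFactor B i κ x i) atTop (𝓝 (transFactor B i κ)) := by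
  refine ((tendsto_setIntegral_Iic_atTop
    (integrable_mulVec_jostFactor (i := i) hB hκ i)).const_add 1).congr fun x => ?_
  rw [congrFun (jostFactor_eq hB hκ x) i]
  simp [volterra, weight]

theorem norm_exp_imag (hκ : κ.re = 0) (y : ℝ) : ‖exp (-(2 * κ * y))‖ = 1 := by
  rw [norm_exp]
  simp [hκ]

/-- The factor `e^{-2κx}` cancels the `x`-dependence of the kernel `e^{2κ(x-y)}`. What remains,
`e^{-2κy}`, has modulus `1` because `κ` is imaginary, so the integrand is integrable on the whole
line. -/
theorem tendsto_exp_mul_jostFactor_atTop (hB : IntegrableEntries B) (hκ : κ.re = 0)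
    (hij : j ≠ i) :
    Tendsto (fun x : ℝ => exp (-(2 * κ * x)) * jostFactor B i κ x j) atTop
      (𝓝 (reflFactor B i j κ)) := by
  have hint : Integrable fun y : ℝ => exp (-(2 * κ * y)) * (B y *ᵥ jostFactor B i κ y) j :=
    (integrable_mulVec_jostFactor (i := i) hB hκ.le j).bdd_mul
      (by fun_prop : Continuous fun y : ℝ => exp (-(2 * κ * y))).aestronglyMeasurable
      (Eventually.of_forall fun y => (norm_exp_imag hκ y).le)
  refine (tendsto_setIntegral_Iic_atTop hint).congr fun x => ?_
  rw [congrFun (jostFactor_eq hB hκ.le x) j]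
  simp only [volterra, weight, Pi.add_apply, if_neg hij, Pi.single_eq_of_ne hij, zero_add]
  rw [← integral_const_mul]
  refine integral_congr_ae (Eventually.of_forall fun y => ?_)
  simp only
  rw [← mul_assoc, ← exp_add]
  ring_nf

theorem continuousOn_picard (hB : IntegrableEntries B) (n : ℕ) (x : ℝ) (k : Fin 2) :
    ContinuousOn (fun κ => picard B i n κ x k) {κ | κ.re ≤ 0} := by
  induction n generalizing x k with
  | zero => exact continuousOn_const
  | succ n ih =>
    exact continuousOn_const.add (continuousOn_volterra hB
      (fun κ hκ => continuous_picard hB hκ n)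
      (fun κ hκ => norm_picard_le_expBound hB hκ n) ih x k)

theorem differentiableOn_picard (hB : IntegrableEntries B) (n : ℕ) (x : ℝ) (k : Fin 2) :
    DifferentiableOn ℂ (fun κ => picard B i n κ x k) {κ | κ.re < 0} := by
  induction n generalizing x k with
  | zero => exact differentiableOn_const _
  | succ n ih =>
    exact (differentiableOn_const _).add (differentiableOn_volterra hB
      (fun κ hκ => continuous_picard hB hκ n)
      (fun κ hκ => norm_picard_le_expBound hB hκ n) ih x k)

theorem tendstoUniformlyOn_picard (hB : IntegrableEntries B) (x : ℝ) (k : Fin 2) :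
    TendstoUniformlyOn (fun n κ => picard B i n κ x k) (fun κ => jostFactor B i κ x k) atTop
      {κ | κ.re ≤ 0} := by
  rw [Metric.tendstoUniformlyOn_iff]
  intro ε hε
  filter_upwards [exists_dist_picard_lt B hε] with n hn κ hκ
  rw [dist_comm]
  exact ((dist_le_pi_dist _ _ k).trans (dist_picard_jostFactor_le hB hκ x n)).trans_lt hn

theorem continuousOn_jostFactor (hB : IntegrableEntries B) (x : ℝ) (k : Fin 2) :
    ContinuousOn (fun κ => jostFactor B i κ x k) {κ | κ.re ≤ 0} :=
  (tendstoUniformlyOn_picard hB x k).continuousOn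
    (Frequently.of_forall fun n => continuousOn_picard hB n x k)

theorem differentiableOn_jostFactor (hB : IntegrableEntries B) (x : ℝ) (k : Fin 2) :
    DifferentiableOn ℂ (fun κ => jostFactor B i κ x k) {κ | κ.re < 0} :=
  ((tendstoUniformlyOn_picard hB x k).mono
    fun _ h => le_of_lt h).tendstoLocallyUniformlyOn.differentiableOn
    (Eventually.of_forall fun n => differentiableOn_picard hB n x k)
    (isOpen_lt continuous_re continuous_const)

theorem continuousOn_transFactor (hB : IntegrableEntries B) :
    ContinuousOn (transFactor B i) {κ | κ.re ≤ 0} := by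
  refine continuousOn_const.add (continuousOn_of_dominated
    (bound := fun y => entryNorm (B y) * expBound B)
    (fun κ hκ => (integrable_mulVec_jostFactor hB hκ i).aestronglyMeasurable)
    (fun κ hκ => Eventually.of_forall fun y => (norm_mulVec_le _ _ _).trans
      (mul_le_mul_of_nonneg_left (norm_jostFactor_le hB hκ y) (entryNorm_nonneg _)))
    (hB.integrable_entryNorm.mul_const _) (Eventually.of_forall fun y => ?_))
  simp only [Matrix.mulVec, dotProduct]
  exact continuousOn_finsetSum _ fun l _ => continuousOn_const.mul (continuousOn_jostFactor hB y l)

theorem differentiableOn_transFactor (hB : IntegrableEntries B) :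
    DifferentiableOn ℂ (transFactor B i) {κ | κ.re < 0} := by
  refine (differentiableOn_const _).add (differentiableOn_integral_of_dominated
    (isOpen_lt continuous_re continuous_const)
    (bound := fun y => entryNorm (B y) * expBound B)
    (fun κ hκ => (integrable_mulVec_jostFactor hB (le_of_lt hκ) i).aestronglyMeasurable)
    (Eventually.of_forall fun y κ hκ => (norm_mulVec_le _ _ _).trans
      (mul_le_mul_of_nonneg_left (norm_jostFactor_le hB (le_of_lt hκ) y) (entryNorm_nonneg _)))
    (hB.integrable_entryNorm.mul_const _) (fun y => ?_))
  simp only [Matrix.mulVec, dotProduct]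
  exact DifferentiableOn.fun_sum fun l _ => (differentiableOn_jostFactor hB y l).const_mul _

theorem continuousOn_reflFactor (hB : IntegrableEntries B) :
    ContinuousOn (reflFactor B i j) {κ | κ.re = 0} := by
  refine continuousOn_of_dominated (bound := fun y => entryNorm (B y) * expBound B)
    (fun κ hκ => AEStronglyMeasurable.mul
      (by fun_prop : Continuous fun y : ℝ => exp (-(2 * κ * y))).aestronglyMeasurable
      (integrable_mulVec_jostFactor hB (le_of_eq hκ) j).aestronglyMeasurable)
    (fun κ hκ => Eventually.of_forall fun y => ?_)
    (hB.integrable_entryNorm.mul_const _) (Eventually.of_forall fun y => ?_)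
  · rw [norm_mul, norm_exp_imag hκ, one_mul]
    exact (norm_mulVec_le _ _ _).trans
      (mul_le_mul_of_nonneg_left (norm_jostFactor_le hB (le_of_eq hκ) y) (entryNorm_nonneg _))
  · simp only [Matrix.mulVec, dotProduct]
    exact (Continuous.continuousOn (by fun_prop)).mul (continuousOn_finsetSum _ fun l _ =>
      continuousOn_const.mul ((continuousOn_jostFactor hB y l).mono fun _ h => le_of_eq h))

end

/-! All four Jost solutions are instances of one notion: the solution that behaves like
`e^{-κx} e_i` at the end `l` of the line, `l'` being the opposite end. -/

theorem mulVec_apply_of_ne {i j : Fin 2} (hij : j ≠ i) (M : Matrix (Fin 2) (Fin 2) ℂ)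
    (v : Fin 2 → ℂ) : (M *ᵥ v) i = M i i * v i + M i j * v j := by
  fin_cases i <;> fin_cases j <;> simp_all [Matrix.mulVec, dotProduct, Fin.sum_univ_two, add_comm]

theorem eq_or_eq_of_ne {i j : Fin 2} (hij : j ≠ i) (k : Fin 2) : k = i ∨ k = j := by
  omega

/-- The constant matrix to which the coefficients tend. -/
def freePart (κ : ℂ) (i : Fin 2) : Matrix (Fin 2) (Fin 2) ℂ :=
  Matrix.diagonal fun k => if k = i then -κ else κ

/-- `A` is traceless, continuous, and differs from its free part by an integrable function. -/
structure Admissible (A : ℝ → Matrix (Fin 2) (Fin 2) ℂ) (κ : ℂ) (i : Fin 2) : Prop where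
  int : IntegrableEntries fun x => A x - freePart κ i
  tr : ∀ x, A x 0 0 + A x 1 1 = 0

/-- `f` is a solution with `f_i = e^{-κx}[1 + o(1)]`, `f_j = o(1)` along `l`. -/
structure IsJost (A : ℝ → Matrix (Fin 2) (Fin 2) ℂ) (κ : ℂ) (i j : Fin 2) (l : Filter ℝ)
    (f : ℝ → Fin 2 → ℂ) : Prop where
  sol : IsSolution A f
  diag : Tendsto (fun x : ℝ => exp (κ * x) * f x i) l (𝓝 1)
  off : Tendsto (fun x : ℝ => f x j) l (𝓝 0)

/-- The properties of a Jost solution at both ends of the line. -/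
structure StrongJost (A : ℝ → Matrix (Fin 2) (Fin 2) ℂ) (κ : ℂ) (i j : Fin 2) (l l' : Filter ℝ)
    (f : ℝ → Fin 2 → ℂ) (t : ℂ) : Prop where
  sol : IsSolution A f
  diag : Tendsto (fun x : ℝ => exp (κ * x) * f x i) l (𝓝 1)
  off : Tendsto (fun x : ℝ => exp (κ * x) * f x j) l (𝓝 0)
  trans : Tendsto (fun x : ℝ => exp (κ * x) * f x i) l' (𝓝 t)
  bdd : IsBoundedUnder (· ≤ ·) l' fun x : ℝ => ‖exp (κ * x) * f x j‖

/-- `l` and `l'` are the two ends of the line, and `e^{-κx}` is bounded at `l`. -/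
def EndPair (κ : ℂ) (l l' : Filter ℝ) : Prop :=
  (l = atBot ∧ l' = atTop ∧ κ.re ≤ 0) ∨ (l = atTop ∧ l' = atBot ∧ 0 ≤ κ.re)

theorem EndPair.symm {κ : ℂ} {l l' : Filter ℝ} (h : EndPair κ l l') : EndPair (-κ) l' l := by
  rcases h with ⟨rfl, rfl, h⟩ | ⟨rfl, rfl, h⟩
  · exact Or.inr ⟨rfl, rfl, by simpa using h⟩
  · exact Or.inl ⟨rfl, rfl, by simpa using h⟩

theorem EndPair.neBot {κ : ℂ} {l l' : Filter ℝ} (h : EndPair κ l l') : l.NeBot := by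
  rcases h with ⟨rfl, rfl, h⟩ | ⟨rfl, rfl, h⟩ <;> infer_instance

theorem EndPair.norm_exp_le {κ : ℂ} {l l' : Filter ℝ} (h : EndPair κ l l') :
    ∀ᶠ x : ℝ in l, ‖exp (-(κ * x))‖ ≤ 1 := by
  have key : ∀ x : ℝ, 0 ≤ κ.re * x → ‖exp (-(κ * x))‖ ≤ 1 := fun x hx => by
    rw [norm_exp, neg_re, re_mul_ofReal]
    exact Real.exp_le_one_iff.2 (neg_nonpos.2 hx)
  rcases h with ⟨rfl, rfl, h⟩ | ⟨rfl, rfl, h⟩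
  · filter_upwards [eventually_le_atBot 0] with x hx
    exact key x (mul_nonneg_of_nonpos_of_nonpos h hx)
  · filter_upwards [eventually_ge_atTop 0] with x hx using key x (mul_nonneg h hx)

theorem EndPair.tendsto_zero {κ : ℂ} {l l' : Filter ℝ} (h : EndPair κ l l') {g : ℝ → ℂ}
    (hg : Tendsto (fun x : ℝ => exp (κ * x) * g x) l (𝓝 0)) : Tendsto g l (𝓝 0) := by
  have hb : IsBoundedUnder (· ≤ ·) l (norm ∘ fun x : ℝ => exp (-(κ * x))) :=
    isBoundedUnder_of_eventually_le h.norm_exp_le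
  refine (hg.zero_mul_isBoundedUnder_le hb).congr fun x => ?_
  rw [mul_comm, ← mul_assoc, ← exp_add, neg_add_cancel, exp_zero, one_mul]

/-! ### Construction of the Jost solutions at either end -/

section

variable {A : ℝ → Matrix (Fin 2) (Fin 2) ℂ} {κ : ℂ} {i j : Fin 2} {l l' : Filter ℝ}

/-- Thus one matrix `A` fits both normalisations, `e^{-κx} e_i` and `e^{κx} e_j`. -/
theorem freePart_neg (hij : j ≠ i) : freePart (-κ) j = freePart κ i := by
  unfold freePart
  congr 1
  funext k
  rcases eq_or_eq_of_ne hij k with rfl | rfl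
  · simp [hij.symm]
  · simp [hij]

theorem freePart_mulVec (κ : ℂ) (i : Fin 2) (v : Fin 2 → ℂ) (k : Fin 2) :
    (freePart κ i *ᵥ v) k = (if k = i then -κ else κ) * v k := by
  rw [freePart, Matrix.mulVec_diagonal]

theorem freePart_neg_left (κ : ℂ) (i : Fin 2) : freePart (-κ) i = -freePart κ i := by
  ext k m
  simp only [freePart, Matrix.diagonal_apply, Matrix.neg_apply]
  split_ifs <;> simp

namespace Admissible

theorem symm (hA : Admissible A κ i) (hij : j ≠ i) : Admissible A (-κ) j :=
  ⟨by simpa only [freePart_neg hij] using hA.int, hA.tr⟩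

theorem trace (hA : Admissible A κ i) (hij : j ≠ i) (x : ℝ) : A x i i + A x j j = 0 := by
  have h := hA.tr x
  fin_cases i <;> fin_cases j <;> simp_all [add_comm]

theorem cont (hA : Admissible A κ i) (k m : Fin 2) : Continuous fun x => A x k m := by
  have h := (hA.int.cont k m).add_const (freePart κ i k m)
  exact h.congr fun x => by simp

/-- This is the system satisfied by `x ↦ f(-x)`; it reduces Jost solutions at `+∞` to those at `-∞`.
-/
theorem reflect (hA : Admissible A κ i) : Admissible (fun x => -A (-x)) (-κ) i := by
  have h : ∀ x k m, (-A (-x) - freePart (-κ) i) k m = -(A (-x) - freePart κ i) k m :=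
    fun x k m => by
      rw [freePart_neg_left]
      simp only [Matrix.sub_apply, Matrix.neg_apply]
      ring
  refine ⟨⟨fun k m => ?_, fun k m => ?_⟩, fun x => ?_⟩
  · simp only [h]
    exact ((hA.int.cont k m).comp continuous_neg).neg
  · simp only [h]
    exact ((hA.int.int k m).comp_neg).neg
  · have := hA.tr (-x)
    simp only [Matrix.neg_apply]
    rw [← neg_add, this, neg_zero]

end Admissible

/-- Multiplication by `e^{-κx}` shifts the exponents `0, 2κ` of the Volterra problem to `-κ, κ`, the
diagonal of the free part. -/
theorem strongJost_jostFactor (hA : Admissible A κ i) (hκ : κ.re ≤ 0) (hij : j ≠ i) :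
    StrongJost A κ i j atBot atTop
      (fun x => exp (-(κ * x)) • jostFactor (fun x => A x - freePart κ i) i κ x)
      (transFactor (fun x => A x - freePart κ i) i κ) := by
  set B := fun x => A x - freePart κ i with hB
  have hcancel : ∀ (x : ℝ) k, exp (κ * x) * (exp (-(κ * x)) • jostFactor B i κ x) k =
      jostFactor B i κ x k := fun x k => by
    rw [Pi.smul_apply, smul_eq_mul, ← mul_assoc, ← exp_add, add_neg_cancel, exp_zero, one_mul]
  have hlim := tendsto_pi_nhds.1 (tendsto_jostFactor_atBot (i := i) hA.int hκ)
  refine ⟨fun x => hasDerivAt_pi.2 fun k => ?_, ?_, ?_, ?_, ?_⟩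
  · have hexp : HasDerivAt (fun x : ℝ => exp (-(κ * x))) (-κ * exp (-(κ * x))) x := by
      convert! ((ofRealCLM.hasDerivAt (x := x)).const_mul κ).neg.cexp using 1
      simp [mul_comm]
    have h := hexp.mul (hasDerivAt_jostFactor (B := B) (i := i) hA.int hκ x k)
    convert! h using 1
    have hAx : A x = B x + freePart κ i := by simp [hB]
    rw [hAx, Matrix.add_mulVec, Pi.add_apply, Matrix.mulVec_smul, freePart_mulVec,
      weight]
    simp only [Pi.smul_apply, smul_eq_mul]
    split_ifs <;> ring
  · simp only [hcancel]
    simpa using hlim i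
  · simp only [hcancel]
    simpa [Pi.single_eq_of_ne hij] using hlim j
  · simp only [hcancel]
    exact tendsto_jostFactor_atTop hA.int hκ
  · simp only [hcancel]
    exact isBoundedUnder_of ⟨expBound B, fun x =>
      (norm_le_pi_norm _ j).trans (norm_jostFactor_le hA.int hκ x)⟩

theorem StrongJost.reflect {f : ℝ → Fin 2 → ℂ} {t : ℂ}
    (hf : StrongJost (fun x => -A (-x)) (-κ) i j atBot atTop f t) :
    StrongJost A κ i j atTop atBot (fun x => f (-x)) t := by
  have h : ∀ k, (fun x : ℝ => exp (κ * x) * f (-x) k) =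
      (fun x : ℝ => exp (-κ * x) * f x k) ∘ Neg.neg := fun k => by
    funext x
    simp
  refine ⟨fun x => ?_, ?_, ?_, ?_, ?_⟩
  · have := (hf.sol (-x)).scomp x (hasDerivAt_neg x)
    rw [Matrix.neg_mulVec, neg_neg, neg_smul, one_smul, neg_neg] at this
    exact this
  · rw [h]
    exact hf.diag.comp tendsto_neg_atTop_atBot
  · rw [h]
    exact hf.off.comp tendsto_neg_atTop_atBot
  · rw [h]
    exact hf.trans.comp tendsto_neg_atBot_atTop
  · obtain ⟨C, hC⟩ := hf.bdd.eventually_le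
    refine isBoundedUnder_of_eventually_le (a := C) ?_
    filter_upwards [tendsto_neg_atBot_atTop.eventually hC] with x hx
    simpa using hx

theorem tendsto_refl_jostFactor (hA : Admissible A κ i) (hκ : κ.re = 0) (hij : j ≠ i) :
    Tendsto (fun x : ℝ => exp (-(κ * x)) *
      (exp (-(κ * x)) • jostFactor (fun x => A x - freePart κ i) i κ x) j) atTop
      (𝓝 (reflFactor (fun x => A x - freePart κ i) i j κ)) := by
  refine (tendsto_exp_mul_jostFactor_atTop hA.int hκ hij).congr fun x => ?_
  rw [Pi.smul_apply, smul_eq_mul, ← mul_assoc, ← exp_add]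
  ring_nf

theorem tendsto_refl_jostFactor_reflect (hA : Admissible A κ i) (hκ : κ.re = 0) (hij : j ≠ i) :
    Tendsto (fun x : ℝ => exp (-(κ * x)) * (exp (-(-κ * (-x : ℝ))) •
      jostFactor (fun x => -A (-x) - freePart (-κ) i) i (-κ) (-x)) j) atBot
      (𝓝 (reflFactor (fun x => -A (-x) - freePart (-κ) i) i j (-κ))) := by
  refine ((tendsto_refl_jostFactor hA.reflect (by simpa using hκ) hij).comp
    tendsto_neg_atBot_atTop).congr fun x => ?_
  simp

theorem exists_strongJost (hA : Admissible A κ i) (hl : EndPair κ l l') (hij : j ≠ i) :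
    ∃ f t, StrongJost A κ i j l l' f t ∧
      (κ.re = 0 → ∃ b, Tendsto (fun x : ℝ => exp (-(κ * x)) * f x j) l' (𝓝 b)) := by
  rcases hl with ⟨rfl, rfl, hκ⟩ | ⟨rfl, rfl, hκ⟩
  · exact ⟨_, _, strongJost_jostFactor hA hκ hij, fun h0 => ⟨_, tendsto_refl_jostFactor hA h0 hij⟩⟩
  · exact ⟨_, _, (strongJost_jostFactor hA.reflect (by simpa using hκ) hij).reflect,
      fun h0 => ⟨_, tendsto_refl_jostFactor_reflect hA h0 hij⟩⟩

/-! Uniqueness of the Jost solutions and the Wronskian. -/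

theorem IsSolution.sub {f g : ℝ → Fin 2 → ℂ} (hf : IsSolution A f) (hg : IsSolution A g) :
    IsSolution A (f - g) := fun x => by
  rw [Pi.sub_apply, Matrix.mulVec_sub]
  exact (hf x).sub (hg x)

theorem IsSolution.const_smul {f : ℝ → Fin 2 → ℂ} (c : ℂ) (hf : IsSolution A f) :
    IsSolution A (c • f) := fun x => by
  rw [Pi.smul_apply, Matrix.mulVec_smul]
  exact (hf x).const_smul c

/-- On a compact interval around both points the entries of `A` are bounded, which gives a Lipschitz
constant for the standard uniqueness theorem. -/
theorem IsSolution.eq_of_apply_eq (hc : ∀ k m, Continuous fun x => A x k m)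
    {f g : ℝ → Fin 2 → ℂ} (hf : IsSolution A f) (hg : IsSolution A g) {x₀ : ℝ}
    (h : f x₀ = g x₀) : f = g := by
  funext x
  have hcA : Continuous fun x => entryNorm (A x) :=
    continuous_finsetSum _ fun k _ => continuous_finsetSum _ fun l _ => (hc k l).norm
  set a := min x x₀ - 1 with ha
  set b := max x x₀ + 1 with hb
  obtain ⟨K, hK⟩ := (isCompact_Icc (a := a) (b := b)).bddAbove_image hcA.continuousOn
  have hx : x ∈ Set.Ioo a b := ⟨by linarith [min_le_left x x₀], by linarith [le_max_left x x₀]⟩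
  have hx₀ : x₀ ∈ Set.Ioo a b :=
    ⟨by linarith [min_le_right x x₀], by linarith [le_max_right x x₀]⟩
  refine ODE_solution_unique_of_mem_Ioo (v := fun t y => A t *ᵥ y) (s := fun _ => Set.univ)
    (K := K.toNNReal) (fun t ht => LipschitzWith.lipschitzOnWith ?_) hx₀
    (fun t _ => ⟨hf t, trivial⟩) (fun t _ => ⟨hg t, trivial⟩) h hx
  refine LipschitzWith.of_dist_le_mul fun y z => ?_
  rw [dist_eq_norm, dist_eq_norm, ← Matrix.mulVec_sub]
  have hKt : entryNorm (A t) ≤ K.toNNReal :=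
    (hK (Set.mem_image_of_mem _ (Set.Ioo_subset_Icc_self ht))).trans (Real.le_coe_toNNReal K)
  refine (pi_norm_le_iff_of_nonneg (by positivity)).2 fun k => (norm_mulVec_le _ _ k).trans ?_
  exact mul_le_mul_of_nonneg_right hKt (norm_nonneg _)

/-- The derivative of the Wronskian is the trace of `A` times the Wronskian, and the trace is zero.
-/
theorem IsSolution.wronskian_eq (hA : Admissible A κ i) (hij : j ≠ i)
    {f g : ℝ → Fin 2 → ℂ} (hf : IsSolution A f) (hg : IsSolution A g) (x y : ℝ) :
    f x i * g x j - f x j * g x i = f y i * g y j - f y j * g y i := by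
  have hd : ∀ x, HasDerivAt (fun x => f x i * g x j - f x j * g x i) 0 x := fun x => by
    have hf' := hasDerivAt_pi.1 (hf x)
    have hg' := hasDerivAt_pi.1 (hg x)
    convert! ((hf' i).mul (hg' j)).sub ((hf' j).mul (hg' i)) using 1
    rw [mulVec_apply_of_ne hij, mulVec_apply_of_ne hij, mulVec_apply_of_ne hij.symm,
      mulVec_apply_of_ne hij.symm]
    linear_combination (-(f x i * g x j) + f x j * g x i) * hA.trace hij x
  exact is_const_of_deriv_eq_zero (fun x => (hd x).differentiableAt) (fun x => (hd x).deriv) x y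

theorem StrongJost.isJost {f : ℝ → Fin 2 → ℂ} {t : ℂ} (hf : StrongJost A κ i j l l' f t)
    (hl : EndPair κ l l') : IsJost A κ i j l f :=
  ⟨hf.sol, hf.diag, hl.tendsto_zero hf.off⟩

/-- The Wronskian of `f - F` and `F` tends to `0` at `l` and is constant, hence zero, so `f - F = c
F`. Comparing `e^{κx}` times the components `i` gives `c = 0`. The condition `f_j = o(1)`, without
the factor `e^{κx}`, is enough because `F_i` stays bounded at `l`. -/
theorem IsJost.eq_strongJost (hA : Admissible A κ i) (hl : EndPair κ l l') (hij : j ≠ i)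
    {f F : ℝ → Fin 2 → ℂ} {t : ℂ} (hf : IsJost A κ i j l f) (hF : StrongJost A κ i j l l' F t) :
    f = F := by
  have := hl.neBot
  have hFj := (hF.isJost hl).off
  have hd := hf.sol.sub hF.sol
  have hdi : Tendsto (fun x : ℝ => exp (κ * x) * (f - F) x i) l (𝓝 0) := by
    have := hf.diag.sub hF.diag
    rw [sub_self] at this
    exact this.congr fun x => by simp [mul_sub]
  have hdj : Tendsto (fun x => (f - F) x j) l (𝓝 0) := by
    simpa using hf.off.sub hFj
  have hFi : IsBoundedUnder (· ≤ ·) l (norm ∘ fun x => F x i) := by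
    have h1 : IsBoundedUnder (· ≤ ·) l fun x : ℝ => ‖exp (κ * x) * F x i‖ :=
      hF.diag.norm.isBoundedUnder_le
    obtain ⟨C, hC⟩ := h1.eventually_le
    refine isBoundedUnder_of_eventually_le (a := C) ?_
    filter_upwards [hC, hl.norm_exp_le] with x hx hx'
    have : F x i = exp (-(κ * x)) * (exp (κ * x) * F x i) := by
      rw [← mul_assoc, ← exp_add, neg_add_cancel, exp_zero, one_mul]
    rw [Function.comp_apply, this, norm_mul]
    calc _ ≤ 1 * C := mul_le_mul hx' hx (norm_nonneg _) zero_le_one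
      _ = C := one_mul C
  have hW : Tendsto (fun x => (f - F) x i * F x j - (f - F) x j * F x i) l (𝓝 0) := by
    have := ((hl.tendsto_zero hdi).mul hFj).sub (hdj.zero_mul_isBoundedUnder_le hFi)
    simpa using this
  have hne : ∀ᶠ x : ℝ in l, exp (κ * x) * F x i ≠ 0 := hF.diag.eventually_ne one_ne_zero
  -- Near `l` the component `F_i` does not vanish; at such a point a zero Wronskian means
  -- proportionality.
  obtain ⟨x₀, hx₀⟩ := hne.exists
  have hFx₀ : F x₀ i ≠ 0 := right_ne_zero_of_mul hx₀
  have hW₀ : (f - F) x₀ i * F x₀ j - (f - F) x₀ j * F x₀ i = 0 :=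
    tendsto_nhds_unique (tendsto_const_nhds.congr fun x =>
      hd.wronskian_eq hA hij hF.sol x₀ x) hW
  have hprop : f - F = ((f - F) x₀ i / F x₀ i) • F := by
    refine hd.eq_of_apply_eq hA.cont (hF.sol.const_smul _) (x₀ := x₀) ?_
    funext k
    rcases eq_or_eq_of_ne hij k with rfl | rfl
    · simp only [Pi.smul_apply, smul_eq_mul]
      field_simp
    · simp only [Pi.smul_apply, smul_eq_mul]
      field_simp
      linear_combination -hW₀
  have hc : (f - F) x₀ i / F x₀ i = 0 := by
    refine tendsto_nhds_unique ?_ hdi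
    have := hF.diag.const_mul ((f - F) x₀ i / F x₀ i)
    rw [mul_one] at this
    refine this.congr fun x => ?_
    rw [congrFun (congrFun hprop x) i]
    simp only [Pi.smul_apply, smul_eq_mul]
    ring
  rw [hc, zero_smul] at hprop
  exact sub_eq_zero.1 hprop

end

/-! The Jost solution and its coefficients at the opposite end. -/

/-- The Jost solution. -/
def jost (A : ℝ → Matrix (Fin 2) (Fin 2) ℂ) (κ : ℂ) (i j : Fin 2) (l : Filter ℝ) :
    ℝ → Fin 2 → ℂ :=
  Classical.epsilon (IsJost A κ i j l)

/-- The coefficient of `e^{-κx} e_i` in the asymptotics at the opposite end. -/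
def transCoeff (A : ℝ → Matrix (Fin 2) (Fin 2) ℂ) (κ : ℂ) (i j : Fin 2) (l l' : Filter ℝ) : ℂ :=
  limUnder l' fun x : ℝ => exp (κ * x) * jost A κ i j l x i

/-- The coefficient of `e^{κx} e_j` in the asymptotics at the opposite end. -/
def reflCoeff (A : ℝ → Matrix (Fin 2) (Fin 2) ℂ) (κ : ℂ) (i j : Fin 2) (l l' : Filter ℝ) : ℂ :=
  limUnder l' fun x : ℝ => exp (-(κ * x)) * jost A κ i j l x j

section

variable {A A' : ℝ → Matrix (Fin 2) (Fin 2) ℂ} {κ : ℂ} {i j : Fin 2} {l l' : Filter ℝ}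

theorem existsUnique_isJost (hA : Admissible A κ i) (hl : EndPair κ l l') (hij : j ≠ i) :
    ∃! f, IsJost A κ i j l f := by
  obtain ⟨F, t, hF, -⟩ := exists_strongJost hA hl hij
  exact ⟨F, hF.isJost hl, fun f hf => hf.eq_strongJost hA hl hij hF⟩

theorem isJost_jost (hA : Admissible A κ i) (hl : EndPair κ l l') (hij : j ≠ i) :
    IsJost A κ i j l (jost A κ i j l) :=
  Classical.epsilon_spec (existsUnique_isJost hA hl hij).exists

theorem IsJost.eq_jost (hA : Admissible A κ i) (hl : EndPair κ l l') (hij : j ≠ i)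
    {f : ℝ → Fin 2 → ℂ} (hf : IsJost A κ i j l f) : f = jost A κ i j l :=
  (existsUnique_isJost hA hl hij).unique hf (isJost_jost hA hl hij)

/-- By uniqueness the chosen solution is the one built from the Volterra equation, and so inherits
its behaviour at both ends. -/
theorem strongJost_jost (hA : Admissible A κ i) (hl : EndPair κ l l') (hij : j ≠ i) :
    StrongJost A κ i j l l' (jost A κ i j l) (transCoeff A κ i j l l') := by
  have := hl.symm.neBot
  obtain ⟨F, t, hF, -⟩ := exists_strongJost hA hl hij
  have hFj := (hF.isJost hl).eq_jost hA hl hij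
  subst hFj
  have ht : transCoeff A κ i j l l' = t := hF.trans.limUnder_eq
  rwa [ht]

theorem StrongJost.transCoeff_eq (hA : Admissible A κ i) (hl : EndPair κ l l') (hij : j ≠ i)
    {f : ℝ → Fin 2 → ℂ} {t : ℂ} (hf : StrongJost A κ i j l l' f t) :
    transCoeff A κ i j l l' = t := by
  have := hl.symm.neBot
  have hfj := (hf.isJost hl).eq_jost hA hl hij
  subst hfj
  exact hf.trans.limUnder_eq

theorem tendsto_reflCoeff (hA : Admissible A κ i) (hl : EndPair κ l l') (hij : j ≠ i)
    (hκ : κ.re = 0) :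
    Tendsto (fun x : ℝ => exp (-(κ * x)) * jost A κ i j l x j) l'
      (𝓝 (reflCoeff A κ i j l l')) := by
  obtain ⟨F, t, hF, hb⟩ := exists_strongJost hA hl hij
  have hFj := (hF.isJost hl).eq_jost hA hl hij
  subst hFj
  obtain ⟨b, hb⟩ := hb hκ
  exact tendsto_nhds_limUnder ⟨b, hb⟩

/-- Both Jost solutions give the same transmission coefficient: it is their Wronskian. -/
theorem transCoeff_symm (hA : Admissible A κ i) (hl : EndPair κ l l') (hij : j ≠ i) :
    transCoeff A (-κ) j i l' l = transCoeff A κ i j l l' := by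
  have := hl.neBot
  have := hl.symm.neBot
  have hF := strongJost_jost hA hl hij
  have hG := strongJost_jost (hA.symm hij) hl.symm hij.symm
  set F := jost A κ i j l
  set G := jost A (-κ) j i l'
  have hprod : ∀ x : ℝ, ∀ a b, (exp (κ * x) * F x a) * (exp (-κ * x) * G x b) = F x a * G x b :=
    fun x a b => by
      rw [mul_mul_mul_comm, ← exp_add, neg_mul, add_neg_cancel, exp_zero, one_mul]
  have hW : ∀ x, F x i * G x j - F x j * G x i = F 0 i * G 0 j - F 0 j * G 0 i := fun x =>
    hF.sol.wronskian_eq hA hij hG.sol x 0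
  have h1 : Tendsto (fun x => F x i * G x j - F x j * G x i) l'
      (𝓝 (transCoeff A κ i j l l')) := by
    have := (hF.trans.mul hG.diag).sub ((hG.off.zero_mul_isBoundedUnder_le hF.bdd))
    rw [mul_one, sub_zero] at this
    refine this.congr fun x => ?_
    rw [mul_comm (exp (-κ * x) * G x i), hprod, hprod]
  have h2 : Tendsto (fun x => F x i * G x j - F x j * G x i) l
      (𝓝 (transCoeff A (-κ) j i l' l)) := by
    have := (hF.diag.mul hG.trans).sub (hF.off.zero_mul_isBoundedUnder_le hG.bdd)
    rw [one_mul, sub_zero] at this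
    refine this.congr fun x => ?_
    rw [hprod, hprod]
  simp only [hW] at h1 h2
  exact (tendsto_nhds_unique h2 tendsto_const_nhds).trans
    (tendsto_nhds_unique tendsto_const_nhds h1)

/-- `G` transforms solutions of `f' = A f` into solutions of `f' = A' f`. -/
def IsGauge (A A' G : ℝ → Matrix (Fin 2) (Fin 2) ℂ) : Prop :=
  ∀ x, ∃ G' : Matrix (Fin 2) (Fin 2) ℂ, (∀ k m, HasDerivAt (fun x => G x k m) (G' k m) x) ∧
    G' + G x * A x = A' x * G x

/-- `G` tends to the diagonal matrix with entries `a`. -/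
def TendstoDiagonal (G : ℝ → Matrix (Fin 2) (Fin 2) ℂ) (l : Filter ℝ) (a : Fin 2 → ℂ) : Prop :=
  ∀ k m, Tendsto (fun x => G x k m) l (𝓝 (Matrix.diagonal a k m))

theorem IsGauge.isSolution {G : ℝ → Matrix (Fin 2) (Fin 2) ℂ} (hG : IsGauge A A' G)
    {f : ℝ → Fin 2 → ℂ} (hf : IsSolution A f) : IsSolution A' fun x => G x *ᵥ f x := fun x => by
  obtain ⟨G', hG', hGA⟩ := hG x
  have h : HasDerivAt (fun x => G x *ᵥ f x) (G' *ᵥ f x + G x *ᵥ (A x *ᵥ f x)) x := by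
    refine hasDerivAt_pi.2 fun k => ?_
    simp only [Matrix.mulVec, dotProduct, Pi.add_apply]
    rw [← Finset.sum_add_distrib]
    exact HasDerivAt.fun_sum fun m _ => (hG' k m).mul (hasDerivAt_pi.1 (hf x) m)
  rwa [Matrix.mulVec_mulVec, ← Matrix.add_mulVec, hGA, ← Matrix.mulVec_mulVec] at h

/-- If `F` is the Jost solution of `A`, then `G F / a_i` is that of `A'`; its asymptotics at `l'`
give the coefficients. Only `a i ≠ 0` is required, not invertibility of `G`, which is what allows `ζ
= 0` later. -/
theorem IsGauge.coeff_eq {G : ℝ → Matrix (Fin 2) (Fin 2) ℂ} (hG : IsGauge A A' G)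
    (hA : Admissible A κ i) (hA' : Admissible A' κ i) (hl : EndPair κ l l') (hij : j ≠ i)
    {a a' : Fin 2 → ℂ} (hGl : TendstoDiagonal G l a) (hGl' : TendstoDiagonal G l' a')
    (ha : a i ≠ 0) :
    transCoeff A' κ i j l l' = a' i / a i * transCoeff A κ i j l l' ∧
      (κ.re = 0 → reflCoeff A' κ i j l l' = a' j / a i * reflCoeff A κ i j l l') := by
  have := hl.symm.neBot
  have hF := strongJost_jost hA hl hij
  set F := jost A κ i j l
  have hcomm : ∀ (x : ℝ) {k m : Fin 2} (_ : m ≠ k) (e : ℂ),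
      e * ((a i)⁻¹ • fun x => G x *ᵥ F x) x k =
        (a i)⁻¹ * (G x k k * (e * F x k) + G x k m * (e * F x m)) := fun x k m hkm e => by
    simp only [Pi.smul_apply, smul_eq_mul]
    rw [mulVec_apply_of_ne hkm]
    ring
  -- The off-diagonal entries of `G` tend to `0` and multiply bounded components; `e` will be
  -- `e^{κx}` or `e^{-κx}`.
  have hlim : ∀ {L : Filter ℝ} {b : Fin 2 → ℂ} (_ : TendstoDiagonal G L b) {k m : Fin 2}
      (_ : m ≠ k) {e : ℝ → ℂ} {t : ℂ} (_ : Tendsto (fun x => e x * F x k) L (𝓝 t))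
      (_ : IsBoundedUnder (· ≤ ·) L fun x => ‖e x * F x m‖),
      Tendsto (fun x => e x * ((a i)⁻¹ • fun x => G x *ᵥ F x) x k) L (𝓝 (b k / a i * t)) :=
    by
    intro L b hGL k m hkm e t hk hm
    have h1 := hGL k k
    have h2 := hGL k m
    rw [Matrix.diagonal_apply_eq] at h1
    rw [Matrix.diagonal_apply_ne _ hkm.symm] at h2
    have := ((h1.mul hk).add (h2.zero_mul_isBoundedUnder_le hm)).const_mul (a i)⁻¹
    rw [add_zero, ← mul_assoc, inv_mul_eq_div] at this
    exact this.congr fun x => (hcomm x hkm (e x)).symm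
  have hf' : IsJost A' κ i j l ((a i)⁻¹ • fun x => G x *ᵥ F x) := by
    refine ⟨(hG.isSolution hF.sol).const_smul _, ?_, hl.tendsto_zero ?_⟩
    · have := hlim hGl hij hF.diag hF.off.norm.isBoundedUnder_le
      rwa [mul_one, div_self ha] at this
    · have := hlim hGl hij.symm hF.off hF.diag.norm.isBoundedUnder_le
      rwa [mul_zero] at this
  have heq := hf'.eq_jost hA' hl hij
  constructor
  · refine Tendsto.limUnder_eq ?_
    rw [← heq]
    exact hlim hGl' hij hF.trans hF.bdd
  · intro hκ
    refine Tendsto.limUnder_eq ?_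
    rw [← heq]
    refine hlim hGl' hij.symm (tendsto_reflCoeff hA hl hij hκ) ?_
    have h := hF.trans.norm.isBoundedUnder_le
    -- For imaginary `κ` both exponentials are unimodular, so the bound known for one serves for the
    -- other.
    have hn : ∀ x : ℝ, ‖exp (-(κ * x)) * F x i‖ = ‖exp (κ * x) * F x i‖ := fun x => by
      rw [norm_mul, norm_mul, norm_exp, norm_exp]
      simp [hκ]
    simpa only [hn] using h

end

/-! Solutions of the Volterra equations give the coefficients. -/

section

variable {A : ℝ → Matrix (Fin 2) (Fin 2) ℂ} {κ : ℂ} {i j : Fin 2}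

theorem transCoeff_atBot_eq (hA : Admissible A κ i) (hκ : κ.re ≤ 0) (hij : j ≠ i) :
    transCoeff A κ i j atBot atTop = transFactor (fun x => A x - freePart κ i) i κ :=
  (strongJost_jostFactor hA hκ hij).transCoeff_eq hA (Or.inl ⟨rfl, rfl, hκ⟩) hij

theorem reflCoeff_atBot_eq (hA : Admissible A κ i) (hκ : κ.re = 0) (hij : j ≠ i) :
    reflCoeff A κ i j atBot atTop = reflFactor (fun x => A x - freePart κ i) i j κ := by
  have hl : EndPair κ atBot atTop := Or.inl ⟨rfl, rfl, hκ.le⟩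
  have h := (((strongJost_jostFactor hA hκ.le hij).isJost hl).eq_jost hA hl hij)
  refine Tendsto.limUnder_eq ?_
  rw [← h]
  exact tendsto_refl_jostFactor hA hκ hij

theorem reflCoeff_atTop_eq (hA : Admissible A κ i) (hκ : κ.re = 0) (hij : j ≠ i) :
    reflCoeff A κ i j atTop atBot =
      reflFactor (fun x => -A (-x) - freePart (-κ) i) i j (-κ) := by
  have hl : EndPair κ atTop atBot := Or.inr ⟨rfl, rfl, hκ.ge⟩
  have hκ' : (-κ).re = 0 := by simpa using hκ
  have h := (((strongJost_jostFactor hA.reflect hκ'.le hij).reflect.isJost hl).eq_jost hA hl hij)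
  refine Tendsto.limUnder_eq ?_
  rw [← h]
  exact tendsto_refl_jostFactor_reflect hA hκ hij

end

/-! The coefficients of the four Jost solutions in these terms. -/

section

variable {A : ℝ → Matrix (Fin 2) (Fin 2) ℂ} {lam : ℂ}

theorem isJostPhi_iff {f : ℝ → Fin 2 → ℂ} : IsJostPhi A lam f ↔ IsJost A (I * lam) 0 1 atBot f :=
  ⟨fun h => ⟨h.sol, h.fst, h.snd⟩, fun h => ⟨h.sol, h.diag, h.off⟩⟩

theorem isJostPsiBar_iff {f : ℝ → Fin 2 → ℂ} :
    IsJostPsiBar A lam f ↔ IsJost A (I * lam) 0 1 atTop f :=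
  ⟨fun h => ⟨h.sol, h.fst, h.snd⟩, fun h => ⟨h.sol, h.diag, h.off⟩⟩

theorem isJostPsi_iff {f : ℝ → Fin 2 → ℂ} :
    IsJostPsi A lam f ↔ IsJost A (-(I * lam)) 1 0 atTop f :=
  ⟨fun h => ⟨h.sol, by simpa only [neg_mul] using h.snd, h.fst⟩,
    fun h => ⟨h.sol, h.off, by simpa only [neg_mul] using h.diag⟩⟩

theorem isJostPhiBar_iff {f : ℝ → Fin 2 → ℂ} :
    IsJostPhiBar A lam f ↔ IsJost A (-(I * lam)) 1 0 atBot f :=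
  ⟨fun h => ⟨h.sol, by simpa only [neg_mul] using h.snd, h.fst⟩,
    fun h => ⟨h.sol, h.off, by simpa only [neg_mul] using h.diag⟩⟩

theorem phi_eq_jost : phi A lam = jost A (I * lam) 0 1 atBot :=
  congrArg Classical.epsilon (funext fun _ => propext isJostPhi_iff)

theorem psiBar_eq_jost : psiBar A lam = jost A (I * lam) 0 1 atTop :=
  congrArg Classical.epsilon (funext fun _ => propext isJostPsiBar_iff)

theorem psi_eq_jost : psi A lam = jost A (-(I * lam)) 1 0 atTop :=
  congrArg Classical.epsilon (funext fun _ => propext isJostPsi_iff)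

theorem phiBar_eq_jost : phiBar A lam = jost A (-(I * lam)) 1 0 atBot :=
  congrArg Classical.epsilon (funext fun _ => propext isJostPhiBar_iff)

theorem oneOverT_eq : oneOverT A lam = transCoeff A (I * lam) 0 1 atBot atTop := by
  rw [oneOverT, transCoeff, phi_eq_jost]

theorem ROverT_eq : ROverT A lam = reflCoeff A (I * lam) 0 1 atBot atTop := by
  rw [ROverT, reflCoeff, phi_eq_jost]

theorem LOverT_eq : LOverT A lam = reflCoeff A (-(I * lam)) 1 0 atTop atBot := by
  rw [LOverT, reflCoeff, psi_eq_jost]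
  simp only [neg_mul, neg_neg]

theorem oneOverTBar_eq : oneOverTBar A lam = transCoeff A (-(I * lam)) 1 0 atBot atTop := by
  rw [oneOverTBar, transCoeff, phiBar_eq_jost]
  simp only [neg_mul]

theorem RBarOverTBar_eq : RBarOverTBar A lam = reflCoeff A (-(I * lam)) 1 0 atBot atTop := by
  rw [RBarOverTBar, reflCoeff, phiBar_eq_jost]
  simp only [neg_mul, neg_neg]

theorem LBarOverTBar_eq : LBarOverTBar A lam = reflCoeff A (I * lam) 0 1 atTop atBot := by
  rw [LBarOverTBar, reflCoeff, psiBar_eq_jost]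

theorem endPair_phi (h : 0 ≤ lam.im) : EndPair (I * lam) atBot atTop :=
  Or.inl ⟨rfl, rfl, by simpa using h⟩

theorem endPair_psi (h : 0 ≤ lam.im) : EndPair (-(I * lam)) atTop atBot :=
  (endPair_phi h).symm

theorem endPair_psiBar (h : lam.im ≤ 0) : EndPair (I * lam) atTop atBot :=
  Or.inr ⟨rfl, rfl, by simpa using h⟩

theorem endPair_phiBar (h : lam.im ≤ 0) : EndPair (-(I * lam)) atBot atTop :=
  (endPair_psiBar h).symm

theorem Admissible.neg_one (hA : Admissible A (I * lam) 0) : Admissible A (-(I * lam)) 1 :=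
  hA.symm one_ne_zero

theorem tDefined_of_admissible (hA : Admissible A (I * lam) 0)
    (h : 0 ≤ lam.im) : TDefined A lam := by
  have hphi := endPair_phi h
  have hpsi := endPair_psi h
  refine ⟨?_, ?_, ?_, ?_⟩
  · simp only [isJostPsi_iff]
    exact existsUnique_isJost hA.neg_one hpsi zero_ne_one
  · simp only [isJostPhi_iff]
    exact existsUnique_isJost hA hphi one_ne_zero
  · rw [oneOverT_eq, ← transCoeff_symm hA hphi one_ne_zero, psi_eq_jost]
    simpa only [neg_mul] using (strongJost_jost hA.neg_one hpsi zero_ne_one).trans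
  · rw [oneOverT_eq, phi_eq_jost]
    exact (strongJost_jost hA hphi one_ne_zero).trans

theorem tBarDefined_of_admissible (hA : Admissible A (I * lam) 0)
    (h : lam.im ≤ 0) : TBarDefined A lam := by
  have hphi := endPair_phiBar h
  have hpsi := endPair_psiBar h
  have hsymm := transCoeff_symm hA hpsi one_ne_zero
  refine ⟨?_, ?_, ?_, ?_⟩
  · simp only [isJostPsiBar_iff]
    exact existsUnique_isJost hA hpsi one_ne_zero
  · simp only [isJostPhiBar_iff]
    exact existsUnique_isJost hA.neg_one hphi zero_ne_one
  · rw [oneOverTBar_eq, hsymm, psiBar_eq_jost]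
    exact (strongJost_jost hA hpsi one_ne_zero).trans
  · rw [oneOverTBar_eq, phiBar_eq_jost]
    simpa only [neg_mul] using (strongJost_jost hA.neg_one hphi zero_ne_one).trans

theorem reflectionDefined_of_admissible (hA : Admissible A (I * lam) 0)
    (h : lam.im = 0) : ReflectionDefined A lam := by
  have h0 : (I * lam).re = 0 := by simp [h]
  have h0' : (-(I * lam)).re = 0 := by simp [h]
  refine ⟨?_, ?_, ?_, ?_⟩
  · rw [ROverT_eq, phi_eq_jost]
    exact tendsto_reflCoeff hA (endPair_phi h.ge) one_ne_zero h0
  · rw [LOverT_eq, psi_eq_jost]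
    simpa only [neg_mul, neg_neg] using
      tendsto_reflCoeff hA.neg_one (endPair_psi h.ge) zero_ne_one h0'
  · rw [RBarOverTBar_eq, phiBar_eq_jost]
    simpa only [neg_mul, neg_neg] using
      tendsto_reflCoeff hA.neg_one (endPair_phiBar h.le) zero_ne_one h0'
  · rw [LBarOverTBar_eq, psiBar_eq_jost]
    exact tendsto_reflCoeff hA (endPair_psiBar h.le) one_ne_zero h0

end

/-! The effect of a gauge transformation on the scattering coefficients. -/

section

variable {A A' G : ℝ → Matrix (Fin 2) (Fin 2) ℂ} {lam : ℂ} {a b : Fin 2 → ℂ}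

theorem IsGauge.phi_coeff (hG : IsGauge A A' G) (hA : Admissible A (I * lam) 0)
    (hA' : Admissible A' (I * lam) 0) (hGa : TendstoDiagonal G atBot a)
    (hGb : TendstoDiagonal G atTop b) (h0 : a 0 ≠ 0) (h : 0 ≤ lam.im) :
    oneOverT A' lam = b 0 / a 0 * oneOverT A lam ∧
      (lam.im = 0 → ROverT A' lam = b 1 / a 0 * ROverT A lam) := by
  simp only [oneOverT_eq, ROverT_eq]
  have := hG.coeff_eq hA hA' (endPair_phi h) one_ne_zero hGa hGb h0
  exact ⟨this.1, fun h => this.2 (by simpa using h)⟩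

/-- A second formula for `1/T`, requiring `b 1 ≠ 0` at `+∞` instead of `a 0 ≠ 0` at `-∞`. It covers
gauges whose upper left entry may vanish. -/
theorem IsGauge.psi_coeff (hG : IsGauge A A' G) (hA : Admissible A (I * lam) 0)
    (hA' : Admissible A' (I * lam) 0) (hGa : TendstoDiagonal G atBot a)
    (hGb : TendstoDiagonal G atTop b) (h1 : b 1 ≠ 0) (h : 0 ≤ lam.im) :
    oneOverT A' lam = a 1 / b 1 * oneOverT A lam ∧
      (lam.im = 0 → LOverT A' lam = a 0 / b 1 * LOverT A lam) := by
  simp only [oneOverT_eq, LOverT_eq, ← transCoeff_symm hA (endPair_phi h) one_ne_zero,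
    ← transCoeff_symm hA' (endPair_phi h) one_ne_zero]
  have := hG.coeff_eq hA.neg_one hA'.neg_one (endPair_psi h) zero_ne_one hGb hGa h1
  exact ⟨this.1, fun h => this.2 (by simpa using h)⟩

theorem IsGauge.phiBar_coeff (hG : IsGauge A A' G) (hA : Admissible A (I * lam) 0)
    (hA' : Admissible A' (I * lam) 0) (hGa : TendstoDiagonal G atBot a)
    (hGb : TendstoDiagonal G atTop b) (h1 : a 1 ≠ 0) (h : lam.im ≤ 0) :
    oneOverTBar A' lam = b 1 / a 1 * oneOverTBar A lam ∧
      (lam.im = 0 → RBarOverTBar A' lam = b 0 / a 1 * RBarOverTBar A lam) := by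
  simp only [oneOverTBar_eq, RBarOverTBar_eq]
  have := hG.coeff_eq hA.neg_one hA'.neg_one (endPair_phiBar h) zero_ne_one hGa hGb h1
  exact ⟨this.1, fun h => this.2 (by simpa using h)⟩

theorem IsGauge.psiBar_coeff (hG : IsGauge A A' G) (hA : Admissible A (I * lam) 0)
    (hA' : Admissible A' (I * lam) 0) (hGa : TendstoDiagonal G atBot a)
    (hGb : TendstoDiagonal G atTop b) (h0 : b 0 ≠ 0) (h : lam.im ≤ 0) :
    oneOverTBar A' lam = a 0 / b 0 * oneOverTBar A lam ∧
      (lam.im = 0 → LBarOverTBar A' lam = a 1 / b 0 * LBarOverTBar A lam) := by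
  simp only [oneOverTBar_eq, LBarOverTBar_eq, transCoeff_symm hA (endPair_psiBar h) one_ne_zero,
    transCoeff_symm hA' (endPair_psiBar h) one_ne_zero]
  have := hG.coeff_eq hA hA' (endPair_psiBar h) one_ne_zero hGb hGa h0
  exact ⟨this.1, fun h => this.2 (by simpa using h)⟩

end

/-! Admissibility of the four systems. -/

/-- Continuous and integrable. -/
structure Potential (f : ℝ → ℂ) : Prop where
  cont : Continuous f
  int : Integrable f

namespace Potential

variable {f g : ℝ → ℂ}

theorem const_mul (hf : Potential f) (c : ℂ) : Potential fun x => c * f x :=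
  ⟨hf.cont.const_mul c, hf.int.const_mul c⟩

theorem neg (hf : Potential f) : Potential fun x => -f x := ⟨hf.cont.neg, hf.int.neg⟩

theorem sub (hf : Potential f) (hg : Potential g) : Potential fun x => f x - g x :=
  ⟨hf.cont.sub hg.cont, hf.int.sub hg.int⟩

theorem zero : Potential fun _ => 0 := ⟨continuous_const, integrable_zero _ _ _⟩

theorem bdd_mul (hf : Potential f) (hg : Continuous g) {C : ℝ} (hC : ∀ x, ‖g x‖ ≤ C) :
    Potential fun x => g x * f x :=
  ⟨hg.mul hf.cont, hf.int.bdd_mul hg.aestronglyMeasurable (Eventually.of_forall hC)⟩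

end Potential

theorem admissible_of_potentials {A : ℝ → Matrix (Fin 2) (Fin 2) ℂ} {lam : ℂ} {d u v : ℝ → ℂ}
    (hd : Potential d) (hu : Potential u) (hv : Potential v)
    (hA : ∀ x, A x = !![-(I * lam) - d x, u x; v x, I * lam + d x]) :
    Admissible A (I * lam) 0 := by
  have h : ∀ x, A x - freePart (I * lam) 0 = !![-d x, u x; v x, d x] := fun x => by
    rw [hA]
    ext k m
    fin_cases k <;> fin_cases m <;> simp [freePart, sub_add_eq_add_sub]
  refine ⟨⟨fun k m => ?_, fun k m => ?_⟩, fun x => ?_⟩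
  · simp only [h]
    fin_cases k <;> fin_cases m
    exacts [hd.neg.cont, hu.cont, hv.cont, hd.cont]
  · simp only [h]
    fin_cases k <;> fin_cases m
    exacts [hd.neg.int, hu.int, hv.int, hd.int]
  · simp [hA]

theorem admissible_gi {q r : ℝ → ℂ} (hq : Potential q) (hr : Potential r)
    (hqr : Potential fun x => q x * r x) (ζ : ℂ) :
    Admissible (giMatrix q r ζ) (I * ζ ^ 2) 0 :=
  admissible_of_potentials (hqr.const_mul (I / 2)) (hq.const_mul ζ) (hr.const_mul ζ) fun _ => rfl

theorem admissible_akns {u v : ℝ → ℂ} (hu : Potential u) (hv : Potential v) (lam : ℂ) :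
    Admissible (aknsMatrix u v lam) (I * lam) 0 :=
  admissible_of_potentials Potential.zero hu hv fun x => by simp [aknsMatrix]

theorem admissible_kn {q r : ℝ → ℂ} (hq : Potential q) (hr : Potential r) (ζ : ℂ) :
    Admissible (knMatrix q r ζ) (I * ζ ^ 2) 0 :=
  admissible_of_potentials Potential.zero (hq.const_mul ζ) (hr.const_mul ζ) fun x => by
    simp [knMatrix]

/-! The potentials built from Schwartz functions. -/

section

variable (q r f : 𝓢(ℝ, ℂ))

theorem potential_schwartz : Potential f := ⟨f.continuous, f.integrable⟩

theorem potential_deriv_schwartz : Potential (deriv f) := by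
  have h := potential_schwartz (SchwartzMap.derivCLM ℂ ℂ f)
  exact ⟨h.cont.congr fun x => SchwartzMap.derivCLM_apply ℂ f x,
    h.int.congr (Eventually.of_forall fun x => SchwartzMap.derivCLM_apply ℂ f x)⟩

theorem exists_norm_schwartz_le : ∃ C, ∀ x, ‖f x‖ ≤ C := by
  obtain ⟨C, -, hC⟩ := f.decay 0 0
  exact ⟨C, fun x => by simpa using hC x⟩

theorem tendsto_schwartz_atBot : Tendsto f atBot (𝓝 0) :=
  f.tendsto_cocompact.mono_left atBot_le_cocompact

theorem tendsto_schwartz_atTop : Tendsto f atTop (𝓝 0) :=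
  f.tendsto_cocompact.mono_left atTop_le_cocompact

theorem Potential.schwartz_mul {g : ℝ → ℂ} (hg : Potential g) : Potential fun x => f x * g x := by
  obtain ⟨C, hC⟩ := exists_norm_schwartz_le f
  exact hg.bdd_mul f.continuous hC

theorem potential_mul : Potential fun x => q x * r x := (potential_schwartz r).schwartz_mul q

theorem potential_vPot : Potential (vPot q r) := by
  have h := (((potential_deriv_schwartz r).const_mul (I / 2)).neg).sub
    (((potential_mul q r).schwartz_mul r).const_mul (1 / 4))
  convert h using 2 with x
  rw [vPot]
  ring

theorem potential_pPot : Potential (pPot q r) := by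
  have h := ((potential_deriv_schwartz q).const_mul (I / 2)).sub
    (((potential_mul q r).schwartz_mul q).const_mul (1 / 4))
  convert h using 2 with x
  rw [pPot]
  ring

theorem E_ne_zero (x : ℝ) : E q r x ≠ 0 := exp_ne_zero _

theorem hasDerivAt_E (x : ℝ) : HasDerivAt (E q r) (I / 2 * (q x * r x) * E q r x) x := by
  have h := hasDerivAt_setIntegral_Iic (potential_mul q r).cont
    (fun _ => (potential_mul q r).int.integrableOn) x
  convert! (h.const_mul (I / 2)).cexp using 1
  rw [E]
  ring

theorem continuous_E : Continuous (E q r) :=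
  continuous_iff_continuousAt.2 fun x => (hasDerivAt_E q r x).continuousAt

theorem tendsto_E_atBot : Tendsto (E q r) atBot (𝓝 1) := by
  have h : Tendsto (fun x : ℝ => ∫ y in Set.Iic x, q y * r y) atBot (𝓝 0) :=
    tendsto_integral_Iic_zero tendsto_id
  have h2 := (continuous_exp.tendsto _).comp (h.const_mul (I / 2))
  rw [mul_zero, exp_zero] at h2
  exact h2

theorem tendsto_E_atTop : Tendsto (E q r) atTop (𝓝 (exp (I * mu q r / 2))) := by
  have h := (tendsto_setIntegral_Iic_atTop (potential_mul q r).int).const_mul (I / 2)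
  have h2 := (continuous_exp.tendsto _).comp h
  rwa [div_mul_eq_mul_div] at h2

/-- Since `q r` is complex-valued, `E` need not be unimodular; absolute integrability of `q r` still
bounds it. The values `c = ±i` give `E²` and `E⁻²`. -/
theorem exists_norm_exp_setIntegral_le (c : ℂ) :
    ∃ C, ∀ x, ‖exp (c * ∫ y in Set.Iic x, q y * r y)‖ ≤ C := by
  refine ⟨Real.exp (‖c‖ * ∫ y, ‖q y * r y‖), fun x => ?_⟩
  refine (norm_exp_le_exp_norm _).trans (Real.exp_le_exp.2 ?_)
  rw [norm_mul]
  refine mul_le_mul_of_nonneg_left ?_ (norm_nonneg _)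
  exact (norm_integral_le_integral_norm _).trans (setIntegral_le_integral
    (potential_mul q r).int.norm (Eventually.of_forall fun _ => norm_nonneg _))

theorem E_sq (x : ℝ) : E q r x ^ 2 = exp (I * ∫ y in Set.Iic x, q y * r y) := by
  rw [E, ← exp_nat_mul]
  congr 1
  push_cast
  ring

theorem potential_qTilde : Potential (qTilde q r) := by
  obtain ⟨C, hC⟩ := exists_norm_exp_setIntegral_le q r I
  exact (potential_schwartz q).bdd_mul ((continuous_E q r).pow 2)
    fun x => by rw [E_sq]; exact hC x

theorem potential_rTilde : Potential (rTilde q r) := by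
  obtain ⟨C, hC⟩ := exists_norm_exp_setIntegral_le q r (-I)
  exact (potential_schwartz r).bdd_mul
    (((continuous_E q r).pow 2).inv₀ fun x => pow_ne_zero 2 (E_ne_zero q r x))
    fun x => by rw [E_sq, ← exp_neg, ← neg_mul]; exact hC x

/-! The gauge transformations between the systems. -/

/-- The derivative `E' = (i/2) q r E` removes the diagonal term, and conjugation multiplies `q` and
`r` by `E²` and `E⁻²`. -/
theorem isGauge_kn (ζ : ℂ) : IsGauge (giMatrix q r ζ) (knMatrix (qTilde q r) (rTilde q r) ζ)
    fun x => !![E q r x, 0; 0, (E q r x)⁻¹] := fun x => by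
  have hE := E_ne_zero q r x
  refine ⟨!![I / 2 * (q x * r x) * E q r x, 0; 0, -(I / 2 * (q x * r x)) * (E q r x)⁻¹],
    fun k m => ?_, ?_⟩
  · fin_cases k <;> fin_cases m
    · exact hasDerivAt_E q r x
    · exact hasDerivAt_const _ _
    · exact hasDerivAt_const _ _
    · change HasDerivAt (fun x => (E q r x)⁻¹) (-(I / 2 * (q x * r x)) * (E q r x)⁻¹) x
      convert! (hasDerivAt_E q r x).inv hE using 1
      field_simp
  · ext k m
    fin_cases k <;> fin_cases m <;>
      simp [giMatrix, knMatrix, qTilde, rTilde, Matrix.mul_apply, Fin.sum_univ_two] <;>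
      field_simp <;> ring

/-- The entry `-(i/2) r` is forced by the first row: its product with `u = q` must reproduce the
diagonal term `-(i/2) q r`. The second row then determines `v`. The determinant is `ζ`. -/
theorem isGauge_uv (ζ : ℂ) : IsGauge (giMatrix q r ζ) (aknsMatrix q (vPot q r) (ζ ^ 2))
    fun x => !![1, 0; -(I / 2) * r x, ζ] := fun x => by
  refine ⟨!![0, 0; -(I / 2) * deriv r x, 0], fun k m => ?_, ?_⟩
  · fin_cases k <;> fin_cases m
    · exact hasDerivAt_const _ _
    · exact hasDerivAt_const _ _
    · exact r.differentiableAt.hasDerivAt.const_mul _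
    · exact hasDerivAt_const _ _
  · ext k m
    fin_cases k <;> fin_cases m <;>
      simp [giMatrix, aknsMatrix, vPot, Matrix.mul_apply, Fin.sum_univ_two]
    all_goals ring_nf
    all_goals simp
    all_goals ring

theorem isGauge_ps (ζ : ℂ) : IsGauge (giMatrix q r ζ) (aknsMatrix (pPot q r) r (ζ ^ 2))
    fun x => !![ζ, I / 2 * q x; 0, 1] := fun x => by
  refine ⟨!![0, I / 2 * deriv q x; 0, 0], fun k m => ?_, ?_⟩
  · fin_cases k <;> fin_cases m
    · exact hasDerivAt_const _ _
    · exact q.differentiableAt.hasDerivAt.const_mul _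
    · exact hasDerivAt_const _ _
    · exact hasDerivAt_const _ _
  · ext k m
    fin_cases k <;> fin_cases m <;>
      simp [giMatrix, aknsMatrix, pPot, Matrix.mul_apply, Fin.sum_univ_two]
    all_goals ring_nf
    all_goals simp
    all_goals ring

theorem isGauge_neg (ζ : ℂ) : IsGauge (giMatrix q r ζ) (giMatrix q r (-ζ))
    fun _ => !![1, 0; 0, -1] := fun x => by
  refine ⟨0, fun k m => hasDerivAt_const _ _, ?_⟩
  ext k m
  fin_cases k <;> fin_cases m <;> simp [giMatrix]

theorem tendstoDiagonal_of {G : ℝ → Matrix (Fin 2) (Fin 2) ℂ} {l : Filter ℝ} {a b : ℂ}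
    (h00 : Tendsto (fun x => G x 0 0) l (𝓝 a)) (h01 : Tendsto (fun x => G x 0 1) l (𝓝 0))
    (h10 : Tendsto (fun x => G x 1 0) l (𝓝 0)) (h11 : Tendsto (fun x => G x 1 1) l (𝓝 b)) :
    TendstoDiagonal G l ![a, b] := fun k m => by
  fin_cases k <;> fin_cases m <;> simpa

theorem tendstoDiagonal_kn {l : Filter ℝ} {e : ℂ} (he : e ≠ 0)
    (h : Tendsto (E q r) l (𝓝 e)) :
    TendstoDiagonal (fun x => !![E q r x, 0; 0, (E q r x)⁻¹]) l ![e, e⁻¹] :=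
  tendstoDiagonal_of h tendsto_const_nhds tendsto_const_nhds (h.inv₀ he)

theorem tendstoDiagonal_uv (ζ : ℂ) {l : Filter ℝ} (h : Tendsto r l (𝓝 0)) :
    TendstoDiagonal (fun x => !![1, 0; -(I / 2) * r x, ζ]) l ![1, ζ] :=
  tendstoDiagonal_of tendsto_const_nhds tendsto_const_nhds
    (by simpa using h.const_mul (-(I / 2))) tendsto_const_nhds

theorem tendstoDiagonal_ps (ζ : ℂ) {l : Filter ℝ} (h : Tendsto q l (𝓝 0)) :
    TendstoDiagonal (fun x => !![ζ, I / 2 * q x; 0, 1]) l ![ζ, 1] :=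
  tendstoDiagonal_of tendsto_const_nhds (by simpa using h.const_mul (I / 2)) tendsto_const_nhds
    tendsto_const_nhds

theorem tendstoDiagonal_neg (l : Filter ℝ) :
    TendstoDiagonal (fun _ => !![1, 0; 0, -1]) l ![1, -1] :=
  tendstoDiagonal_of tendsto_const_nhds tendsto_const_nhds tendsto_const_nhds tendsto_const_nhds

end

/-! Dependence of the AKNS coefficients on the spectral parameter. -/

/-- The off-diagonal matrix of the AKNS potentials. -/
def offDiag (u v : ℝ → ℂ) (x : ℝ) : Matrix (Fin 2) (Fin 2) ℂ := !![0, u x; v x, 0]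

section

variable {u v : ℝ → ℂ} {lam : ℂ}

/-- The remainder is independent of `λ`, which therefore enters the Volterra equation only through
its kernel. The system (1.1) lacks this property, so regularity in `λ` is obtained here. -/
theorem aknsMatrix_sub_freePart (lam : ℂ) (x : ℝ) :
    aknsMatrix u v lam x - freePart (I * lam) 0 = offDiag u v x := by
  ext k m
  fin_cases k <;> fin_cases m <;> simp [aknsMatrix, offDiag, freePart]

theorem aknsMatrix_sub_freePart_one (lam : ℂ) (x : ℝ) :
    aknsMatrix u v lam x - freePart (-(I * lam)) 1 = offDiag u v x := by
  rw [freePart_neg one_ne_zero, aknsMatrix_sub_freePart]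

theorem neg_aknsMatrix_sub_freePart (lam : ℂ) (x : ℝ) :
    -aknsMatrix u v lam (-x) - freePart (-(I * lam)) 0 = -offDiag u v (-x) := by
  rw [freePart_neg_left, ← neg_sub', aknsMatrix_sub_freePart]

theorem neg_aknsMatrix_sub_freePart_one (lam : ℂ) (x : ℝ) :
    -aknsMatrix u v lam (-x) - freePart (- -(I * lam)) 1 = -offDiag u v (-x) := by
  rw [freePart_neg_left, ← neg_sub', aknsMatrix_sub_freePart_one]

theorem integrableEntries_offDiag (hu : Potential u) (hv : Potential v) :
    IntegrableEntries (offDiag u v) := by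
  simpa only [aknsMatrix_sub_freePart] using (admissible_akns hu hv 0).int

theorem integrableEntries_offDiag_reflect (hu : Potential u) (hv : Potential v) :
    IntegrableEntries fun x => -offDiag u v (-x) := by
  simpa only [neg_aknsMatrix_sub_freePart] using (admissible_akns hu hv 0).reflect.int

theorem oneOverT_akns (hu : Potential u) (hv : Potential v) (h : 0 ≤ lam.im) :
    oneOverT (aknsMatrix u v lam) lam = transFactor (offDiag u v) 0 (I * lam) := by
  rw [oneOverT_eq, transCoeff_atBot_eq (admissible_akns hu hv lam) (by simpa using h) one_ne_zero]
  simp only [aknsMatrix_sub_freePart]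

theorem oneOverTBar_akns (hu : Potential u) (hv : Potential v) (h : lam.im ≤ 0) :
    oneOverTBar (aknsMatrix u v lam) lam = transFactor (offDiag u v) 1 (-(I * lam)) := by
  rw [oneOverTBar_eq,
    transCoeff_atBot_eq (admissible_akns hu hv lam).neg_one (by simpa using h) zero_ne_one]
  simp only [aknsMatrix_sub_freePart_one]

theorem ROverT_akns (hu : Potential u) (hv : Potential v) (h : lam.im = 0) :
    ROverT (aknsMatrix u v lam) lam = reflFactor (offDiag u v) 0 1 (I * lam) := by
  rw [ROverT_eq, reflCoeff_atBot_eq (admissible_akns hu hv lam) (by simpa using h) one_ne_zero]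
  simp only [aknsMatrix_sub_freePart]

theorem RBarOverTBar_akns (hu : Potential u) (hv : Potential v) (h : lam.im = 0) :
    RBarOverTBar (aknsMatrix u v lam) lam = reflFactor (offDiag u v) 1 0 (-(I * lam)) := by
  rw [RBarOverTBar_eq,
    reflCoeff_atBot_eq (admissible_akns hu hv lam).neg_one (by simpa using h) zero_ne_one]
  simp only [aknsMatrix_sub_freePart_one]

theorem LOverT_akns (hu : Potential u) (hv : Potential v) (h : lam.im = 0) :
    LOverT (aknsMatrix u v lam) lam =
      reflFactor (fun x => -offDiag u v (-x)) 1 0 (- -(I * lam)) := by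
  rw [LOverT_eq,
    reflCoeff_atTop_eq (admissible_akns hu hv lam).neg_one (by simpa using h) zero_ne_one]
  simp only [neg_aknsMatrix_sub_freePart_one]

theorem LBarOverTBar_akns (hu : Potential u) (hv : Potential v) (h : lam.im = 0) :
    LBarOverTBar (aknsMatrix u v lam) lam =
      reflFactor (fun x => -offDiag u v (-x)) 0 1 (-(I * lam)) := by
  rw [LBarOverTBar_eq,
    reflCoeff_atTop_eq (admissible_akns hu hv lam) (by simpa using h) one_ne_zero]
  simp only [neg_aknsMatrix_sub_freePart]

theorem continuousOn_oneOverT_akns (hu : Potential u) (hv : Potential v) :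
    ContinuousOn (fun l => oneOverT (aknsMatrix u v l) l) {l | 0 ≤ l.im} := by
  refine ContinuousOn.congr ?_ fun l hl => oneOverT_akns hu hv hl
  exact (continuousOn_transFactor (integrableEntries_offDiag hu hv)).comp
    (by fun_prop : Continuous fun l => I * l).continuousOn fun l hl => by simpa using hl

theorem differentiableOn_oneOverT_akns (hu : Potential u) (hv : Potential v) :
    DifferentiableOn ℂ (fun l => oneOverT (aknsMatrix u v l) l) {l | 0 < l.im} := by
  refine DifferentiableOn.congr ?_ fun l hl => oneOverT_akns hu hv (le_of_lt hl)
  exact (differentiableOn_transFactor (integrableEntries_offDiag hu hv)).fun_comp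
    (by fun_prop : Differentiable ℂ fun l => I * l).differentiableOn fun l hl => by simpa using hl

theorem continuousOn_oneOverTBar_akns (hu : Potential u) (hv : Potential v) :
    ContinuousOn (fun l => oneOverTBar (aknsMatrix u v l) l) {l | l.im ≤ 0} := by
  refine ContinuousOn.congr ?_ fun l hl => oneOverTBar_akns hu hv hl
  exact (continuousOn_transFactor (integrableEntries_offDiag hu hv)).comp
    (by fun_prop : Continuous fun l => -(I * l)).continuousOn fun l hl => by simpa using hl

theorem differentiableOn_oneOverTBar_akns (hu : Potential u) (hv : Potential v) :
    DifferentiableOn ℂ (fun l => oneOverTBar (aknsMatrix u v l) l) {l | l.im < 0} := by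
  refine DifferentiableOn.congr ?_ fun l hl => oneOverTBar_akns hu hv (le_of_lt hl)
  exact (differentiableOn_transFactor (integrableEntries_offDiag hu hv)).fun_comp
    (by fun_prop : Differentiable ℂ fun l => -(I * l)).differentiableOn
    fun l hl => by simpa using hl

theorem continuous_ROverT_akns (hu : Potential u) (hv : Potential v) :
    Continuous fun l : ℝ => ROverT (aknsMatrix u v l) l := by
  simp only [ROverT_akns hu hv (ofReal_im _)]
  exact (continuousOn_reflFactor (integrableEntries_offDiag hu hv)).comp_continuous
    (by fun_prop) fun l => by simp

theorem continuous_RBarOverTBar_akns (hu : Potential u) (hv : Potential v) :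
    Continuous fun l : ℝ => RBarOverTBar (aknsMatrix u v l) l := by
  simp only [RBarOverTBar_akns hu hv (ofReal_im _)]
  exact (continuousOn_reflFactor (integrableEntries_offDiag hu hv)).comp_continuous
    (by fun_prop) fun l => by simp

theorem continuous_LOverT_akns (hu : Potential u) (hv : Potential v) :
    Continuous fun l : ℝ => LOverT (aknsMatrix u v l) l := by
  simp only [LOverT_akns hu hv (ofReal_im _)]
  exact (continuousOn_reflFactor (integrableEntries_offDiag_reflect hu hv)).comp_continuous
    (by fun_prop) fun l => by simp

theorem continuous_LBarOverTBar_akns (hu : Potential u) (hv : Potential v) :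
    Continuous fun l : ℝ => LBarOverTBar (aknsMatrix u v l) l := by
  simp only [LBarOverTBar_akns hu hv (ofReal_im _)]
  exact (continuousOn_reflFactor (integrableEntries_offDiag_reflect hu hv)).comp_continuous
    (by fun_prop) fun l => by simp

theorem continuous_oneOverT_akns_real (hu : Potential u) (hv : Potential v) :
    Continuous fun l : ℝ => oneOverT (aknsMatrix u v l) l :=
  (continuousOn_oneOverT_akns hu hv).comp_continuous continuous_ofReal fun l => by simp

theorem continuous_oneOverTBar_akns_real (hu : Potential u) (hv : Potential v) :
    Continuous fun l : ℝ => oneOverTBar (aknsMatrix u v l) l :=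
  (continuousOn_oneOverTBar_akns hu hv).comp_continuous continuous_ofReal fun l => by simp

end

/-- The reciprocal of a function that is continuous on `S` and holomorphic in `U ⊆ S` is
meromorphic in `U`, and continuous away from its poles and the zeros outside `U`. -/
theorem meromorphicOn_and_continuousOn_of_inv {F g : ℂ → ℂ} {S U : Set ℂ} {Z : Set ℂ}
    (hU : IsOpen U) (hUS : U ⊆ S) (hF : ∀ l ∈ S, F l = 1 / g l) (hg : ContinuousOn g S)
    (hgU : DifferentiableOn ℂ g U) (hZ : ∀ l ∈ S, l ∉ U → g l = 0 → l ∈ Z) :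
    MeromorphicOn F U ∧ ContinuousOn F (S \ (polesIn F U ∪ Z)) := by
  have hFg : ∀ l ∈ U, F =ᶠ[𝓝 l] g⁻¹ := fun l hl => by
    filter_upwards [hU.mem_nhds hl] with z hz
    rw [hF z (hUS hz), one_div, Pi.inv_apply]
  have hga : ∀ l ∈ U, AnalyticAt ℂ g l := fun l hl => hgU.analyticAt (hU.mem_nhds hl)
  have hmero : MeromorphicOn F U := fun l hl =>
    (hga l hl).meromorphicAt.inv.congr ((hFg l hl).symm.filter_mono nhdsWithin_le_nhds)
  refine ⟨hmero, fun l ⟨hlS, hl⟩ => ?_⟩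
  rw [Set.mem_union, not_or] at hl
  by_cases h0 : g l = 0
  · have hlU : l ∈ U := by
      by_contra hlU
      exact hl.2 (hZ l hlS hlU h0)
    -- If `g` vanishes near `l`, then `F` is locally `0` by the convention `1/0 = 0`, and is
    -- continuous. Otherwise the zero is isolated, `F` tends to infinity, and `l` is one of the
    -- excluded poles.
    rcases (hga l hlU).eventually_eq_zero_or_eventually_ne_zero with hz | hz
    · have hF0 : F =ᶠ[𝓝 l] fun _ => 0 := by
        filter_upwards [hFg l hlU, hz] with z hz1 hz2
        rw [hz1, Pi.inv_apply, hz2, inv_zero]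
      exact (continuousAt_const.congr hF0.symm).continuousWithinAt
    · refine absurd ⟨hlU, ?_⟩ hl.1
      rw [← tendsto_cobounded_iff_meromorphicOrderAt_neg (hmero l hlU)]
      have hg0 : Tendsto g (𝓝[≠] l) (𝓝[≠] 0) := by
        refine tendsto_nhdsWithin_iff.2 ⟨?_, hz⟩
        have := (hga l hlU).continuousAt.tendsto.mono_left (nhdsWithin_le_nhds (s := {l}ᶜ))
        rwa [h0] at this
      exact (tendsto_inv₀_nhdsNE_zero.comp hg0).congr'
        ((hFg l hlU).symm.filter_mono nhdsWithin_le_nhds)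
  · refine (((hg l hlS).inv₀ h0).congr (fun z hz => ?_) ?_).mono Set.sdiff_subset
    · rw [hF z hz, one_div, Pi.inv_apply]
    · rw [hF l hlS, one_div, Pi.inv_apply]

/-! Relations between the coefficients of the four systems. -/

section

variable (q r : 𝓢(ℝ, ℂ)) (ζ : ℂ)

theorem admissible_gi_schwartz : Admissible (giMatrix q r ζ) (I * ζ ^ 2) 0 :=
  admissible_gi (potential_schwartz q) (potential_schwartz r) (potential_mul q r) ζ

theorem admissible_kn_schwartz :
    Admissible (knMatrix (qTilde q r) (rTilde q r) ζ) (I * ζ ^ 2) 0 :=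
  admissible_kn (potential_qTilde q r) (potential_rTilde q r) ζ

theorem admissible_uv (lam : ℂ) : Admissible (aknsMatrix q (vPot q r) lam) (I * lam) 0 :=
  admissible_akns (potential_schwartz q) (potential_vPot q r) lam

theorem admissible_ps (lam : ℂ) : Admissible (aknsMatrix (pPot q r) r lam) (I * lam) 0 :=
  admissible_akns (potential_pPot q r) (potential_schwartz r) lam

theorem kn_coeff (h : 0 ≤ (ζ ^ 2).im) :
    oneOverT (knMatrix (qTilde q r) (rTilde q r) ζ) (ζ ^ 2) =
      exp (I * mu q r / 2) * oneOverT (giMatrix q r ζ) (ζ ^ 2) ∧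
    ((ζ ^ 2).im = 0 → ROverT (knMatrix (qTilde q r) (rTilde q r) ζ) (ζ ^ 2) =
      (exp (I * mu q r / 2))⁻¹ * ROverT (giMatrix q r ζ) (ζ ^ 2)) ∧
    ((ζ ^ 2).im = 0 → LOverT (knMatrix (qTilde q r) (rTilde q r) ζ) (ζ ^ 2) =
      exp (I * mu q r / 2) * LOverT (giMatrix q r ζ) (ζ ^ 2)) := by
  have he := exp_ne_zero (I * mu q r / 2)
  have hbot := tendstoDiagonal_kn q r one_ne_zero (tendsto_E_atBot q r)
  have htop := tendstoDiagonal_kn q r he (tendsto_E_atTop q r)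
  have h1 := (isGauge_kn q r ζ).phi_coeff (admissible_gi_schwartz q r ζ)
    (admissible_kn_schwartz q r ζ) hbot htop (by simp) h
  have h2 := (isGauge_kn q r ζ).psi_coeff (admissible_gi_schwartz q r ζ)
    (admissible_kn_schwartz q r ζ) hbot htop (by simp) h
  exact ⟨by simpa using h1.1, fun h => by simpa using h1.2 h, fun h => by simpa using h2.2 h⟩

theorem kn_coeffBar (h : (ζ ^ 2).im ≤ 0) :
    oneOverTBar (knMatrix (qTilde q r) (rTilde q r) ζ) (ζ ^ 2) =
      (exp (I * mu q r / 2))⁻¹ * oneOverTBar (giMatrix q r ζ) (ζ ^ 2) ∧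
    ((ζ ^ 2).im = 0 → RBarOverTBar (knMatrix (qTilde q r) (rTilde q r) ζ) (ζ ^ 2) =
      exp (I * mu q r / 2) * RBarOverTBar (giMatrix q r ζ) (ζ ^ 2)) ∧
    ((ζ ^ 2).im = 0 → LBarOverTBar (knMatrix (qTilde q r) (rTilde q r) ζ) (ζ ^ 2) =
      (exp (I * mu q r / 2))⁻¹ * LBarOverTBar (giMatrix q r ζ) (ζ ^ 2)) := by
  have he := exp_ne_zero (I * mu q r / 2)
  have hbot := tendstoDiagonal_kn q r one_ne_zero (tendsto_E_atBot q r)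
  have htop := tendstoDiagonal_kn q r he (tendsto_E_atTop q r)
  have h1 := (isGauge_kn q r ζ).phiBar_coeff (admissible_gi_schwartz q r ζ)
    (admissible_kn_schwartz q r ζ) hbot htop (by simp) h
  have h2 := (isGauge_kn q r ζ).psiBar_coeff (admissible_gi_schwartz q r ζ)
    (admissible_kn_schwartz q r ζ) hbot htop (by simp) h
  exact ⟨by simpa using h1.1, fun h => by simpa using h1.2 h, fun h => by simpa using h2.2 h⟩

/-- The gauge tends to `diag(1, ζ)`. The solution `φ` sees the entry `1`, so its relations hold for
all `ζ`; `ψ` sees `ζ`, which makes `L/T` change by `1/ζ`. Multiplying by `ζ²` keeps the relation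
true at `ζ = 0`. The roles are exchanged for the barred coefficients and again for `diag(ζ, 1)`. -/
theorem uv_coeff (h : 0 ≤ (ζ ^ 2).im) :
    oneOverT (aknsMatrix q (vPot q r) (ζ ^ 2)) (ζ ^ 2) = oneOverT (giMatrix q r ζ) (ζ ^ 2) ∧
    ((ζ ^ 2).im = 0 → ROverT (aknsMatrix q (vPot q r) (ζ ^ 2)) (ζ ^ 2) =
      ζ * ROverT (giMatrix q r ζ) (ζ ^ 2)) ∧
    ((ζ ^ 2).im = 0 → ζ ^ 2 * LOverT (aknsMatrix q (vPot q r) (ζ ^ 2)) (ζ ^ 2) =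
      ζ * LOverT (giMatrix q r ζ) (ζ ^ 2)) := by
  have hbot := tendstoDiagonal_uv r ζ (tendsto_schwartz_atBot r)
  have htop := tendstoDiagonal_uv r ζ (tendsto_schwartz_atTop r)
  have h1 := (isGauge_uv q r ζ).phi_coeff (admissible_gi_schwartz q r ζ)
    (admissible_uv q r _) hbot htop (by simp) h
  refine ⟨by simpa using h1.1, fun h => by simpa using h1.2 h, fun h0 => ?_⟩
  by_cases hζ : ζ = 0
  · simp [hζ]
  · have h2 := ((isGauge_uv q r ζ).psi_coeff (admissible_gi_schwartz q r ζ)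
      (admissible_uv q r _) hbot htop (by simpa using hζ) h).2 h0
    rw [h2]
    simp
    field_simp

theorem uv_coeffBar (h : (ζ ^ 2).im ≤ 0) :
    oneOverTBar (aknsMatrix q (vPot q r) (ζ ^ 2)) (ζ ^ 2) =
      oneOverTBar (giMatrix q r ζ) (ζ ^ 2) ∧
    ((ζ ^ 2).im = 0 → ζ ^ 2 * RBarOverTBar (aknsMatrix q (vPot q r) (ζ ^ 2)) (ζ ^ 2) =
      ζ * RBarOverTBar (giMatrix q r ζ) (ζ ^ 2)) ∧
    ((ζ ^ 2).im = 0 → LBarOverTBar (aknsMatrix q (vPot q r) (ζ ^ 2)) (ζ ^ 2) =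
      ζ * LBarOverTBar (giMatrix q r ζ) (ζ ^ 2)) := by
  have hbot := tendstoDiagonal_uv r ζ (tendsto_schwartz_atBot r)
  have htop := tendstoDiagonal_uv r ζ (tendsto_schwartz_atTop r)
  have h1 := (isGauge_uv q r ζ).psiBar_coeff (admissible_gi_schwartz q r ζ)
    (admissible_uv q r _) hbot htop (by simp) h
  refine ⟨by simpa using h1.1, fun h0 => ?_, fun h => by simpa using h1.2 h⟩
  by_cases hζ : ζ = 0
  · simp [hζ]
  · have h2 := ((isGauge_uv q r ζ).phiBar_coeff (admissible_gi_schwartz q r ζ)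
      (admissible_uv q r _) hbot htop (by simpa using hζ) h).2 h0
    rw [h2]
    simp
    field_simp

theorem ps_coeff (h : 0 ≤ (ζ ^ 2).im) :
    oneOverT (aknsMatrix (pPot q r) r (ζ ^ 2)) (ζ ^ 2) = oneOverT (giMatrix q r ζ) (ζ ^ 2) ∧
    ((ζ ^ 2).im = 0 → ζ ^ 2 * ROverT (aknsMatrix (pPot q r) r (ζ ^ 2)) (ζ ^ 2) =
      ζ * ROverT (giMatrix q r ζ) (ζ ^ 2)) ∧
    ((ζ ^ 2).im = 0 → LOverT (aknsMatrix (pPot q r) r (ζ ^ 2)) (ζ ^ 2) =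
      ζ * LOverT (giMatrix q r ζ) (ζ ^ 2)) := by
  have hbot := tendstoDiagonal_ps q ζ (tendsto_schwartz_atBot q)
  have htop := tendstoDiagonal_ps q ζ (tendsto_schwartz_atTop q)
  have h1 := (isGauge_ps q r ζ).psi_coeff (admissible_gi_schwartz q r ζ)
    (admissible_ps q r _) hbot htop (by simp) h
  refine ⟨by simpa using h1.1, fun h0 => ?_, fun h => by simpa using h1.2 h⟩
  by_cases hζ : ζ = 0
  · simp [hζ]
  · have h2 := ((isGauge_ps q r ζ).phi_coeff (admissible_gi_schwartz q r ζ)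
      (admissible_ps q r _) hbot htop (by simpa using hζ) h).2 h0
    rw [h2]
    simp
    field_simp

theorem ps_coeffBar (h : (ζ ^ 2).im ≤ 0) :
    oneOverTBar (aknsMatrix (pPot q r) r (ζ ^ 2)) (ζ ^ 2) =
      oneOverTBar (giMatrix q r ζ) (ζ ^ 2) ∧
    ((ζ ^ 2).im = 0 → RBarOverTBar (aknsMatrix (pPot q r) r (ζ ^ 2)) (ζ ^ 2) =
      ζ * RBarOverTBar (giMatrix q r ζ) (ζ ^ 2)) ∧
    ((ζ ^ 2).im = 0 → ζ ^ 2 * LBarOverTBar (aknsMatrix (pPot q r) r (ζ ^ 2)) (ζ ^ 2) =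
      ζ * LBarOverTBar (giMatrix q r ζ) (ζ ^ 2)) := by
  have hbot := tendstoDiagonal_ps q ζ (tendsto_schwartz_atBot q)
  have htop := tendstoDiagonal_ps q ζ (tendsto_schwartz_atTop q)
  have h1 := (isGauge_ps q r ζ).phiBar_coeff (admissible_gi_schwartz q r ζ)
    (admissible_ps q r _) hbot htop (by simp) h
  refine ⟨by simpa using h1.1, fun h => by simpa using h1.2 h, fun h0 => ?_⟩
  by_cases hζ : ζ = 0
  · simp [hζ]
  · have h2 := ((isGauge_ps q r ζ).psiBar_coeff (admissible_gi_schwartz q r ζ)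
      (admissible_ps q r _) hbot htop (by simpa using hζ) h).2 h0
    rw [h2]
    simp
    field_simp

theorem neg_coeff (h : 0 ≤ (ζ ^ 2).im) :
    oneOverT (giMatrix q r (-ζ)) (ζ ^ 2) = oneOverT (giMatrix q r ζ) (ζ ^ 2) ∧
    ((ζ ^ 2).im = 0 →
      ROverT (giMatrix q r (-ζ)) (ζ ^ 2) = -ROverT (giMatrix q r ζ) (ζ ^ 2)) ∧
    ((ζ ^ 2).im = 0 →
      LOverT (giMatrix q r (-ζ)) (ζ ^ 2) = -LOverT (giMatrix q r ζ) (ζ ^ 2)) := by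
  have hA' : Admissible (giMatrix q r (-ζ)) (I * ζ ^ 2) 0 := by
    simpa only [neg_sq] using admissible_gi_schwartz q r (-ζ)
  have h1 := (isGauge_neg q r ζ).phi_coeff (admissible_gi_schwartz q r ζ) hA'
    (tendstoDiagonal_neg _) (tendstoDiagonal_neg _) (by simp) h
  have h2 := (isGauge_neg q r ζ).psi_coeff (admissible_gi_schwartz q r ζ) hA'
    (tendstoDiagonal_neg _) (tendstoDiagonal_neg _) (by simp) h
  exact ⟨by simpa using h1.1, fun h => by simpa using h1.2 h, fun h => by simpa using h2.2 h⟩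

theorem neg_coeffBar (h : (ζ ^ 2).im ≤ 0) :
    oneOverTBar (giMatrix q r (-ζ)) (ζ ^ 2) = oneOverTBar (giMatrix q r ζ) (ζ ^ 2) ∧
    ((ζ ^ 2).im = 0 →
      RBarOverTBar (giMatrix q r (-ζ)) (ζ ^ 2) = -RBarOverTBar (giMatrix q r ζ) (ζ ^ 2)) ∧
    ((ζ ^ 2).im = 0 →
      LBarOverTBar (giMatrix q r (-ζ)) (ζ ^ 2) = -LBarOverTBar (giMatrix q r ζ) (ζ ^ 2)) := by
  have hA' : Admissible (giMatrix q r (-ζ)) (I * ζ ^ 2) 0 := by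
    simpa only [neg_sq] using admissible_gi_schwartz q r (-ζ)
  have h1 := (isGauge_neg q r ζ).phiBar_coeff (admissible_gi_schwartz q r ζ) hA'
    (tendstoDiagonal_neg _) (tendstoDiagonal_neg _) (by simp) h
  have h2 := (isGauge_neg q r ζ).psiBar_coeff (admissible_gi_schwartz q r ζ) hA'
    (tendstoDiagonal_neg _) (tendstoDiagonal_neg _) (by simp) h
  exact ⟨by simpa using h1.1, fun h => by simpa using h1.2 h, fun h => by simpa using h2.2 h⟩

/-! The coefficients at `ζ = 0`, where the Kaup-Newell system is trivial. -/

theorem transCoeff_of_eq_zero {A : ℝ → Matrix (Fin 2) (Fin 2) ℂ} {i j : Fin 2}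
    (hA : Admissible A 0 i) (hij : j ≠ i) (h0 : ∀ x, A x = 0) :
    transCoeff A 0 i j atBot atTop = 1 := by
  refine StrongJost.transCoeff_eq (f := fun _ => Pi.single i 1) hA
    (Or.inl ⟨rfl, rfl, le_rfl⟩) hij ⟨fun x => ?_, ?_, ?_, ?_, ?_⟩
  · rw [h0, Matrix.zero_mulVec]
    exact hasDerivAt_const _ _
  · simp
  · simp [Pi.single_eq_of_ne hij]
  · simp
  · simpa [Pi.single_eq_of_ne hij] using
      isBoundedUnder_of ⟨(0 : ℝ), fun _ : ℝ => le_rfl⟩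

theorem knMatrix_zero (x : ℝ) : knMatrix (qTilde q r) (rTilde q r) 0 x = 0 := by
  ext k m
  fin_cases k <;> fin_cases m <;> simp [knMatrix]

/-- At `ζ = 0` the Kaup-Newell solutions are constant, so its `1/T` is `1`; it is also a multiple of
the `1/T` of (1.1). -/
theorem oneOverT_gi_zero : oneOverT (giMatrix q r 0) 0 ≠ 0 := by
  have h := (kn_coeff q r 0 (by simp)).1
  have hA := admissible_kn_schwartz q r 0
  rw [oneOverT_eq] at h
  simp only [ne_eq, OfNat.ofNat_ne_zero, not_false_eq_true, zero_pow, mul_zero] at h hA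
  rw [transCoeff_of_eq_zero hA one_ne_zero (knMatrix_zero q r)] at h
  intro h0
  rw [h0, mul_zero] at h
  exact one_ne_zero h

theorem oneOverTBar_gi_zero : oneOverTBar (giMatrix q r 0) 0 ≠ 0 := by
  have h := (kn_coeffBar q r 0 (by simp)).1
  have hA := (admissible_kn_schwartz q r 0).neg_one
  rw [oneOverTBar_eq] at h
  simp only [ne_eq, OfNat.ofNat_ne_zero, not_false_eq_true, zero_pow, mul_zero, neg_zero] at h hA
  rw [transCoeff_of_eq_zero hA zero_ne_one (knMatrix_zero q r)] at h
  intro h0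
  rw [h0, mul_zero] at h
  exact one_ne_zero h

theorem sqrt_sq (l : ℂ) : l.sqrt ^ 2 = l := by
  rw [Complex.sqrt]
  exact_mod_cast cpow_nat_inv_pow l two_ne_zero

theorem sqrt_ne_zero {l : ℂ} (hl : l ≠ 0) : l.sqrt ≠ 0 := fun h => hl (by
  rw [← sqrt_sq l, h, zero_pow two_ne_zero])

end

/-! ### The transmission and reflection coefficients as functions of `λ = ζ²` -/

section

variable (q r : 𝓢(ℝ, ℂ))

theorem Tfun_eq {l : ℂ} (h : 0 ≤ l.im) :
    Tfun q r l = 1 / oneOverT (aknsMatrix q (vPot q r) l) l := by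
  have := (uv_coeff q r l.sqrt (by rwa [sqrt_sq])).1
  rw [sqrt_sq] at this
  rw [Tfun, T, this]

theorem TBarFun_eq {l : ℂ} (h : l.im ≤ 0) :
    TBarFun q r l = 1 / oneOverTBar (aknsMatrix q (vPot q r) l) l := by
  have := (uv_coeffBar q r l.sqrt (by rwa [sqrt_sq])).1
  rw [sqrt_sq] at this
  rw [TBarFun, TBar, this]

theorem mem_singT_of_uv {l : ℝ} (h : oneOverT (aknsMatrix q (vPot q r) l) l = 0) :
    l ∈ singT q r := by
  have := (uv_coeff q r (l : ℂ).sqrt (by simp [sqrt_sq])).1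
  rw [sqrt_sq, h] at this
  exact this.symm

theorem mem_singT_of_ps {l : ℝ} (h : oneOverT (aknsMatrix (pPot q r) r l) l = 0) :
    l ∈ singT q r := by
  have := (ps_coeff q r (l : ℂ).sqrt (by simp [sqrt_sq])).1
  rw [sqrt_sq, h] at this
  exact this.symm

theorem mem_singTBar_of_uv {l : ℝ} (h : oneOverTBar (aknsMatrix q (vPot q r) l) l = 0) :
    l ∈ singTBar q r := by
  have := (uv_coeffBar q r (l : ℂ).sqrt (by simp [sqrt_sq])).1
  rw [sqrt_sq, h] at this
  exact this.symm

theorem mem_singTBar_of_ps {l : ℝ} (h : oneOverTBar (aknsMatrix (pPot q r) r l) l = 0) :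
    l ∈ singTBar q r := by
  have := (ps_coeffBar q r (l : ℂ).sqrt (by simp [sqrt_sq])).1
  rw [sqrt_sq, h] at this
  exact this.symm

theorem meromorphicOn_and_continuousOn_Tfun :
    MeromorphicOn (Tfun q r) {l : ℂ | 0 < l.im} ∧
      ContinuousOn (Tfun q r) ({l : ℂ | 0 ≤ l.im} \
        (polesIn (Tfun q r) {l : ℂ | 0 < l.im} ∪ (fun t : ℝ => (t : ℂ)) '' singT q r)) := by
  have hu := potential_schwartz q
  have hv := potential_vPot q r
  refine meromorphicOn_and_continuousOn_of_inv (isOpen_lt continuous_const continuous_im)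
    (Set.ofPred_subset_ofPred.2 fun l hl => hl.le)
    (fun l hl => Tfun_eq q r hl) (continuousOn_oneOverT_akns hu hv)
    (differentiableOn_oneOverT_akns hu hv) fun l hl hl' h0 => ?_
  have him : ((l.re : ℝ) : ℂ) = l :=
    Complex.ext (by simp) (by simpa using le_antisymm hl (not_lt.1 hl'))
  exact ⟨l.re, mem_singT_of_uv q r (by rwa [him]), him⟩

theorem meromorphicOn_and_continuousOn_TBarFun :
    MeromorphicOn (TBarFun q r) {l : ℂ | l.im < 0} ∧
      ContinuousOn (TBarFun q r) ({l : ℂ | l.im ≤ 0} \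
        (polesIn (TBarFun q r) {l : ℂ | l.im < 0} ∪ (fun t : ℝ => (t : ℂ)) '' singTBar q r)) := by
  have hu := potential_schwartz q
  have hv := potential_vPot q r
  refine meromorphicOn_and_continuousOn_of_inv (isOpen_lt continuous_im continuous_const)
    (Set.ofPred_subset_ofPred.2 fun l hl => hl.le)
    (fun l hl => TBarFun_eq q r hl) (continuousOn_oneOverTBar_akns hu hv)
    (differentiableOn_oneOverTBar_akns hu hv) fun l hl hl' h0 => ?_
  have him : ((l.re : ℝ) : ℂ) = l :=
    Complex.ext (by simp) (by simpa using le_antisymm (not_lt.1 hl') hl)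
  exact ⟨l.re, mem_singTBar_of_uv q r (by rwa [him]), him⟩

theorem transmission_eq (ζ : ℂ) (h : 0 ≤ (ζ ^ 2).im) :
    T (giMatrix q r ζ) (ζ ^ 2) =
        exp (I * mu q r / 2) * T (knMatrix (qTilde q r) (rTilde q r) ζ) (ζ ^ 2) ∧
      T (giMatrix q r ζ) (ζ ^ 2) = T (aknsMatrix q (vPot q r) (ζ ^ 2)) (ζ ^ 2) ∧
      T (giMatrix q r ζ) (ζ ^ 2) = T (aknsMatrix (pPot q r) r (ζ ^ 2)) (ζ ^ 2) := by
  simp only [T, (kn_coeff q r ζ h).1, (uv_coeff q r ζ h).1, (ps_coeff q r ζ h).1, and_true]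
  rw [one_div, one_div, mul_inv, mul_inv_cancel_left₀ (exp_ne_zero _)]

theorem transmissionBar_eq (ζ : ℂ) (h : (ζ ^ 2).im ≤ 0) :
    TBar (giMatrix q r ζ) (ζ ^ 2) =
        exp (-(I * mu q r / 2)) * TBar (knMatrix (qTilde q r) (rTilde q r) ζ) (ζ ^ 2) ∧
      TBar (giMatrix q r ζ) (ζ ^ 2) = TBar (aknsMatrix q (vPot q r) (ζ ^ 2)) (ζ ^ 2) ∧
      TBar (giMatrix q r ζ) (ζ ^ 2) = TBar (aknsMatrix (pPot q r) r (ζ ^ 2)) (ζ ^ 2) := by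
  simp only [TBar, (kn_coeffBar q r ζ h).1, (uv_coeffBar q r ζ h).1, (ps_coeffBar q r ζ h).1,
    and_true]
  rw [← exp_neg, one_div, one_div, mul_inv, mul_inv_cancel_left₀ (exp_ne_zero _)]

theorem exp_eq_sq_half (z : ℂ) : exp (I * z) = exp (I * z / 2) * exp (I * z / 2) := by
  rw [← exp_add, add_halves]

theorem exp_neg_eq_sq_half (z : ℂ) :
    exp (-(I * z)) = (exp (I * z / 2))⁻¹ * (exp (I * z / 2))⁻¹ := by
  rw [exp_neg, exp_eq_sq_half, mul_inv]

theorem exp_neg_half (z : ℂ) : exp (-(I * z / 2)) = (exp (I * z / 2))⁻¹ := exp_neg _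

theorem reflection_eq (ζ : ℂ) (h : (ζ ^ 2).im = 0) :
    (ζ * R (giMatrix q r ζ) (ζ ^ 2) =
        ζ * exp (I * mu q r) * R (knMatrix (qTilde q r) (rTilde q r) ζ) (ζ ^ 2) ∧
      ζ * R (giMatrix q r ζ) (ζ ^ 2) = R (aknsMatrix q (vPot q r) (ζ ^ 2)) (ζ ^ 2) ∧
      ζ * R (giMatrix q r ζ) (ζ ^ 2) =
        ζ ^ 2 * R (aknsMatrix (pPot q r) r (ζ ^ 2)) (ζ ^ 2)) ∧
    (ζ * RBar (giMatrix q r ζ) (ζ ^ 2) =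
        ζ * exp (-(I * mu q r)) * RBar (knMatrix (qTilde q r) (rTilde q r) ζ) (ζ ^ 2) ∧
      ζ * RBar (giMatrix q r ζ) (ζ ^ 2) =
        ζ ^ 2 * RBar (aknsMatrix q (vPot q r) (ζ ^ 2)) (ζ ^ 2) ∧
      ζ * RBar (giMatrix q r ζ) (ζ ^ 2) = RBar (aknsMatrix (pPot q r) r (ζ ^ 2)) (ζ ^ 2)) ∧
    (ζ * L (giMatrix q r ζ) (ζ ^ 2) =
        ζ * L (knMatrix (qTilde q r) (rTilde q r) ζ) (ζ ^ 2) ∧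
      ζ * L (giMatrix q r ζ) (ζ ^ 2) = ζ ^ 2 * L (aknsMatrix q (vPot q r) (ζ ^ 2)) (ζ ^ 2) ∧
      ζ * L (giMatrix q r ζ) (ζ ^ 2) = L (aknsMatrix (pPot q r) r (ζ ^ 2)) (ζ ^ 2)) ∧
    (ζ * LBar (giMatrix q r ζ) (ζ ^ 2) =
        ζ * LBar (knMatrix (qTilde q r) (rTilde q r) ζ) (ζ ^ 2) ∧
      ζ * LBar (giMatrix q r ζ) (ζ ^ 2) = LBar (aknsMatrix q (vPot q r) (ζ ^ 2)) (ζ ^ 2) ∧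
      ζ * LBar (giMatrix q r ζ) (ζ ^ 2) =
        ζ ^ 2 * LBar (aknsMatrix (pPot q r) r (ζ ^ 2)) (ζ ^ 2)) := by
  have he := exp_ne_zero (I * mu q r / 2)
  obtain ⟨t1, t2, t3⟩ := transmission_eq q r ζ h.ge
  obtain ⟨s1, s2, s3⟩ := transmissionBar_eq q r ζ h.le
  rw [exp_neg_half] at s1
  obtain ⟨-, k1, k2⟩ := kn_coeff q r ζ h.ge
  obtain ⟨-, k3, k4⟩ := kn_coeffBar q r ζ h.le
  obtain ⟨-, u1, u2⟩ := uv_coeff q r ζ h.ge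
  obtain ⟨-, u3, u4⟩ := uv_coeffBar q r ζ h.le
  obtain ⟨-, p1, p2⟩ := ps_coeff q r ζ h.ge
  obtain ⟨-, p3, p4⟩ := ps_coeffBar q r ζ h.le
  -- Everything is expressed through `e^{iμ/2}`: for `R` and `R̄` the factors of numerator and
  -- transmission coefficient combine to `e^{±iμ}`, for `L` and `L̄` they cancel.
  rw [exp_eq_sq_half, exp_neg_eq_sq_half]
  refine ⟨⟨?_, ?_, ?_⟩, ⟨?_, ?_, ?_⟩, ⟨?_, ?_, ?_⟩, ?_, ?_, ?_⟩ <;> simp only [R, RBar, L, LBar]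
  · rw [t1, k1 h]
    field_simp
  · rw [← t2, u1 h, mul_assoc]
  · rw [← t3, ← mul_assoc, ← mul_assoc, p1 h]
  · rw [s1, k3 h]
    field_simp
  · rw [← s2, ← mul_assoc, ← mul_assoc, u3 h]
  · rw [← s3, p3 h, mul_assoc]
  · rw [t1, k2 h]
    field_simp
  · rw [← t2, ← mul_assoc, ← mul_assoc, u2 h]
  · rw [← t3, p2 h, mul_assoc]
  · rw [s1, k4 h]
    field_simp
  · rw [← s2, u4 h, mul_assoc]
  · rw [← s3, ← mul_assoc, ← mul_assoc, p4 h]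

theorem reflection_div_even (ζ : ℂ) (h : (ζ ^ 2).im = 0) :
    R (giMatrix q r (-ζ)) ((-ζ) ^ 2) / (-ζ) = R (giMatrix q r ζ) (ζ ^ 2) / ζ ∧
      RBar (giMatrix q r (-ζ)) ((-ζ) ^ 2) / (-ζ) = RBar (giMatrix q r ζ) (ζ ^ 2) / ζ ∧
      L (giMatrix q r (-ζ)) ((-ζ) ^ 2) / (-ζ) = L (giMatrix q r ζ) (ζ ^ 2) / ζ ∧
      LBar (giMatrix q r (-ζ)) ((-ζ) ^ 2) / (-ζ) = LBar (giMatrix q r ζ) (ζ ^ 2) / ζ := by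
  obtain ⟨h1, h2, h3⟩ := neg_coeff q r ζ h.ge
  obtain ⟨h4, h5, h6⟩ := neg_coeffBar q r ζ h.le
  simp only [R, RBar, L, LBar, T, TBar, neg_sq, h1, h2 h, h3 h, h4, h5 h, h6 h, neg_mul,
    neg_div_neg_eq, and_self]

theorem div_eq_of_mul_eq_sq_mul {ζ a b : ℂ} (hζ : ζ ≠ 0) (h : ζ * a = ζ ^ 2 * b) : b = a / ζ := by
  rw [eq_div_iff hζ]
  refine mul_left_cancel₀ hζ ?_
  rw [h]
  ring

theorem exists_extension_reflection_div :
    ∃ fR fRBar fL fLBar : ℝ → ℂ,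
      (∀ l : ℝ, l ≠ 0 →
        fR l = R (giMatrix q r (l : ℂ).sqrt) l / (l : ℂ).sqrt ∧
        fRBar l = RBar (giMatrix q r (l : ℂ).sqrt) l / (l : ℂ).sqrt ∧
        fL l = L (giMatrix q r (l : ℂ).sqrt) l / (l : ℂ).sqrt ∧
        fLBar l = LBar (giMatrix q r (l : ℂ).sqrt) l / (l : ℂ).sqrt) ∧
      ContinuousOn fR (singT q r)ᶜ ∧ ContinuousOn fRBar (singTBar q r)ᶜ ∧
      ContinuousOn fL (singT q r)ᶜ ∧ ContinuousOn fLBar (singTBar q r)ᶜ := by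
  have hq := potential_schwartz q
  have hr := potential_schwartz r
  have hv := potential_vPot q r
  have hp := potential_pPot q r
  -- For each coefficient the witness is taken from the AKNS system whose relation in (a) carries
  -- the factor `λ = ζ²`; dividing that relation by `ζ²` identifies it with the quotient by `ζ`. It
  -- is defined and continuous through `λ = 0`.
  refine ⟨fun l => R (aknsMatrix (pPot q r) r l) l, fun l => RBar (aknsMatrix q (vPot q r) l) l,
    fun l => L (aknsMatrix q (vPot q r) l) l, fun l => LBar (aknsMatrix (pPot q r) r l) l,
    fun l hl => ?_, ?_, ?_, ?_, ?_⟩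
  · have hζ := sqrt_ne_zero (ofReal_ne_zero.2 hl)
    obtain ⟨⟨-, -, h1⟩, ⟨-, h2, -⟩, ⟨-, h3, -⟩, -, -, h4⟩ :=
      reflection_eq q r (l : ℂ).sqrt (by simp [sqrt_sq])
    have h1' := div_eq_of_mul_eq_sq_mul hζ h1
    have h2' := div_eq_of_mul_eq_sq_mul hζ h2
    have h3' := div_eq_of_mul_eq_sq_mul hζ h3
    have h4' := div_eq_of_mul_eq_sq_mul hζ h4
    rw [sqrt_sq] at h1' h2' h3' h4'
    exact ⟨h1', h2', h3', h4'⟩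
  · exact (continuous_ROverT_akns hp hr).continuousOn.mul (continuousOn_const.div
      (continuous_oneOverT_akns_real hp hr).continuousOn fun l hl h0 =>
        hl (mem_singT_of_ps q r h0))
  · exact (continuous_RBarOverTBar_akns hq hv).continuousOn.mul (continuousOn_const.div
      (continuous_oneOverTBar_akns_real hq hv).continuousOn fun l hl h0 =>
        hl (mem_singTBar_of_uv q r h0))
  · exact (continuous_LOverT_akns hq hv).continuousOn.mul (continuousOn_const.div
      (continuous_oneOverT_akns_real hq hv).continuousOn fun l hl h0 =>
        hl (mem_singT_of_uv q r h0))
  · exact (continuous_LBarOverTBar_akns hp hr).continuousOn.mul (continuousOn_const.div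
      (continuous_oneOverTBar_akns_real hp hr).continuousOn fun l hl h0 =>
        hl (mem_singTBar_of_ps q r h0))

end

end Scattering

end

theorem theorem3p6 (q r : 𝓢(ℝ, ℂ)) :
    -- the scattering coefficients of the four systems are well defined
    (∀ ζ : ℂ, 0 ≤ (ζ ^ 2).im →
      Scattering.TDefined (Scattering.giMatrix q r ζ) (ζ ^ 2) ∧
      Scattering.TDefined
        (Scattering.knMatrix (Scattering.qTilde q r) (Scattering.rTilde q r) ζ) (ζ ^ 2) ∧
      Scattering.TDefined (Scattering.aknsMatrix q (Scattering.vPot q r) (ζ ^ 2)) (ζ ^ 2) ∧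
      Scattering.TDefined (Scattering.aknsMatrix (Scattering.pPot q r) r (ζ ^ 2)) (ζ ^ 2)) ∧
    (∀ ζ : ℂ, (ζ ^ 2).im ≤ 0 →
      Scattering.TBarDefined (Scattering.giMatrix q r ζ) (ζ ^ 2) ∧
      Scattering.TBarDefined
        (Scattering.knMatrix (Scattering.qTilde q r) (Scattering.rTilde q r) ζ) (ζ ^ 2) ∧
      Scattering.TBarDefined (Scattering.aknsMatrix q (Scattering.vPot q r) (ζ ^ 2)) (ζ ^ 2) ∧
      Scattering.TBarDefined (Scattering.aknsMatrix (Scattering.pPot q r) r (ζ ^ 2)) (ζ ^ 2)) ∧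
    (∀ ζ : ℂ, (ζ ^ 2).im = 0 →
      Scattering.ReflectionDefined (Scattering.giMatrix q r ζ) (ζ ^ 2) ∧
      Scattering.ReflectionDefined
        (Scattering.knMatrix (Scattering.qTilde q r) (Scattering.rTilde q r) ζ) (ζ ^ 2) ∧
      Scattering.ReflectionDefined
        (Scattering.aknsMatrix q (Scattering.vPot q r) (ζ ^ 2)) (ζ ^ 2) ∧
      Scattering.ReflectionDefined
        (Scattering.aknsMatrix (Scattering.pPot q r) r (ζ ^ 2)) (ζ ^ 2)) ∧
    -- (a) the transmission coefficients
    (∀ ζ l : ℂ, l = ζ ^ 2 → 0 ≤ l.im →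
      Scattering.T (Scattering.giMatrix q r ζ) l =
        exp (I * Scattering.mu q r / 2) * Scattering.T
          (Scattering.knMatrix (Scattering.qTilde q r) (Scattering.rTilde q r) ζ) l ∧
      Scattering.T (Scattering.giMatrix q r ζ) l =
        Scattering.T (Scattering.aknsMatrix q (Scattering.vPot q r) l) l ∧
      Scattering.T (Scattering.giMatrix q r ζ) l =
        Scattering.T (Scattering.aknsMatrix (Scattering.pPot q r) r l) l) ∧
    (∀ ζ l : ℂ, l = ζ ^ 2 → l.im ≤ 0 →
      Scattering.TBar (Scattering.giMatrix q r ζ) l =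
        exp (-(I * Scattering.mu q r / 2)) * Scattering.TBar
          (Scattering.knMatrix (Scattering.qTilde q r) (Scattering.rTilde q r) ζ) l ∧
      Scattering.TBar (Scattering.giMatrix q r ζ) l =
        Scattering.TBar (Scattering.aknsMatrix q (Scattering.vPot q r) l) l ∧
      Scattering.TBar (Scattering.giMatrix q r ζ) l =
        Scattering.TBar (Scattering.aknsMatrix (Scattering.pPot q r) r l) l) ∧
    -- (a) the reflection coefficients
    (∀ ζ l : ℂ, l = ζ ^ 2 → l.im = 0 →
      (ζ * Scattering.R (Scattering.giMatrix q r ζ) l =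
        ζ * exp (I * Scattering.mu q r) * Scattering.R
          (Scattering.knMatrix (Scattering.qTilde q r) (Scattering.rTilde q r) ζ) l ∧
      ζ * Scattering.R (Scattering.giMatrix q r ζ) l =
        Scattering.R (Scattering.aknsMatrix q (Scattering.vPot q r) l) l ∧
      ζ * Scattering.R (Scattering.giMatrix q r ζ) l =
        l * Scattering.R (Scattering.aknsMatrix (Scattering.pPot q r) r l) l) ∧
      (ζ * Scattering.RBar (Scattering.giMatrix q r ζ) l =
        ζ * exp (-(I * Scattering.mu q r)) * Scattering.RBar
          (Scattering.knMatrix (Scattering.qTilde q r) (Scattering.rTilde q r) ζ) l ∧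
      ζ * Scattering.RBar (Scattering.giMatrix q r ζ) l =
        l * Scattering.RBar (Scattering.aknsMatrix q (Scattering.vPot q r) l) l ∧
      ζ * Scattering.RBar (Scattering.giMatrix q r ζ) l =
        Scattering.RBar (Scattering.aknsMatrix (Scattering.pPot q r) r l) l) ∧
      (ζ * Scattering.L (Scattering.giMatrix q r ζ) l =
        ζ * Scattering.L
          (Scattering.knMatrix (Scattering.qTilde q r) (Scattering.rTilde q r) ζ) l ∧
      ζ * Scattering.L (Scattering.giMatrix q r ζ) l =
        l * Scattering.L (Scattering.aknsMatrix q (Scattering.vPot q r) l) l ∧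
      ζ * Scattering.L (Scattering.giMatrix q r ζ) l =
        Scattering.L (Scattering.aknsMatrix (Scattering.pPot q r) r l) l) ∧
      (ζ * Scattering.LBar (Scattering.giMatrix q r ζ) l =
        ζ * Scattering.LBar
          (Scattering.knMatrix (Scattering.qTilde q r) (Scattering.rTilde q r) ζ) l ∧
      ζ * Scattering.LBar (Scattering.giMatrix q r ζ) l =
        Scattering.LBar (Scattering.aknsMatrix q (Scattering.vPot q r) l) l ∧
      ζ * Scattering.LBar (Scattering.giMatrix q r ζ) l =
        l * Scattering.LBar (Scattering.aknsMatrix (Scattering.pPot q r) r l) l)) ∧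
    -- (b) `T`
    ((∀ ζ : ℂ, 0 ≤ (ζ ^ 2).im →
      Scattering.T (Scattering.giMatrix q r (-ζ)) ((-ζ) ^ 2) =
        Scattering.T (Scattering.giMatrix q r ζ) (ζ ^ 2)) ∧
      MeromorphicOn (Scattering.Tfun q r) {l : ℂ | 0 < l.im} ∧
      ContinuousOn (Scattering.Tfun q r) ({l : ℂ | 0 ≤ l.im} \
        (Scattering.polesIn (Scattering.Tfun q r) {l : ℂ | 0 < l.im} ∪
          (fun t : ℝ => (t : ℂ)) '' Scattering.singT q r))) ∧
    -- (c) `T̄`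
    ((∀ ζ : ℂ, (ζ ^ 2).im ≤ 0 →
      Scattering.TBar (Scattering.giMatrix q r (-ζ)) ((-ζ) ^ 2) =
        Scattering.TBar (Scattering.giMatrix q r ζ) (ζ ^ 2)) ∧
      MeromorphicOn (Scattering.TBarFun q r) {l : ℂ | l.im < 0} ∧
      ContinuousOn (Scattering.TBarFun q r) ({l : ℂ | l.im ≤ 0} \
        (Scattering.polesIn (Scattering.TBarFun q r) {l : ℂ | l.im < 0} ∪
          (fun t : ℝ => (t : ℂ)) '' Scattering.singTBar q r))) ∧
    -- (d) the reflection coefficients divided by `ζ`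
    (∀ ζ : ℂ, (ζ ^ 2).im = 0 → ζ ≠ 0 →
      Scattering.R (Scattering.giMatrix q r (-ζ)) ((-ζ) ^ 2) / (-ζ) =
        Scattering.R (Scattering.giMatrix q r ζ) (ζ ^ 2) / ζ ∧
      Scattering.RBar (Scattering.giMatrix q r (-ζ)) ((-ζ) ^ 2) / (-ζ) =
        Scattering.RBar (Scattering.giMatrix q r ζ) (ζ ^ 2) / ζ ∧
      Scattering.L (Scattering.giMatrix q r (-ζ)) ((-ζ) ^ 2) / (-ζ) =
        Scattering.L (Scattering.giMatrix q r ζ) (ζ ^ 2) / ζ ∧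
      Scattering.LBar (Scattering.giMatrix q r (-ζ)) ((-ζ) ^ 2) / (-ζ) =
        Scattering.LBar (Scattering.giMatrix q r ζ) (ζ ^ 2) / ζ) ∧
    (0 ∉ Scattering.singT q r ∧ 0 ∉ Scattering.singTBar q r) ∧
    (∃ fR fRBar fL fLBar : ℝ → ℂ,
      (∀ l : ℝ, l ≠ 0 →
        fR l = Scattering.R (Scattering.giMatrix q r (l : ℂ).sqrt) l / (l : ℂ).sqrt ∧
        fRBar l = Scattering.RBar (Scattering.giMatrix q r (l : ℂ).sqrt) l / (l : ℂ).sqrt ∧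
        fL l = Scattering.L (Scattering.giMatrix q r (l : ℂ).sqrt) l / (l : ℂ).sqrt ∧
        fLBar l = Scattering.LBar (Scattering.giMatrix q r (l : ℂ).sqrt) l / (l : ℂ).sqrt) ∧
      ContinuousOn fR (Scattering.singT q r)ᶜ ∧
      ContinuousOn fRBar (Scattering.singTBar q r)ᶜ ∧
      ContinuousOn fL (Scattering.singT q r)ᶜ ∧
      ContinuousOn fLBar (Scattering.singTBar q r)ᶜ) := by
  open Scattering in
  refine ⟨fun ζ h => ?_, fun ζ h => ?_, fun ζ h => ?_, ?_, ?_, ?_, ⟨fun ζ h => ?_, ?_⟩,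
    ⟨fun ζ h => ?_, ?_⟩, fun ζ h _ => reflection_div_even q r ζ h, ⟨?_, ?_⟩,
    exists_extension_reflection_div q r⟩
  · exact ⟨tDefined_of_admissible (admissible_gi_schwartz q r ζ) h,
      tDefined_of_admissible (admissible_kn_schwartz q r ζ) h,
      tDefined_of_admissible (admissible_uv q r _) h,
      tDefined_of_admissible (admissible_ps q r _) h⟩
  · exact ⟨tBarDefined_of_admissible (admissible_gi_schwartz q r ζ) h,
      tBarDefined_of_admissible (admissible_kn_schwartz q r ζ) h,
      tBarDefined_of_admissible (admissible_uv q r _) h,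
      tBarDefined_of_admissible (admissible_ps q r _) h⟩
  · exact ⟨reflectionDefined_of_admissible (admissible_gi_schwartz q r ζ) h,
      reflectionDefined_of_admissible (admissible_kn_schwartz q r ζ) h,
      reflectionDefined_of_admissible (admissible_uv q r _) h,
      reflectionDefined_of_admissible (admissible_ps q r _) h⟩
  · rintro ζ _ rfl h
    exact transmission_eq q r ζ h
  · rintro ζ _ rfl h
    exact transmissionBar_eq q r ζ h
  · rintro ζ _ rfl h
    exact reflection_eq q r ζ h
  · rw [neg_sq, T, T, (neg_coeff q r ζ h).1]
  · exact meromorphicOn_and_continuousOn_Tfun q r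
  · rw [neg_sq, TBar, TBar, (neg_coeffBar q r ζ h).1]
  · exact meromorphicOn_and_continuousOn_TBarFun q r
  · simpa [singT, Complex.sqrt_zero] using oneOverT_gi_zero q r
  · simpa [singTBar, Complex.sqrt_zero] using oneOverTBar_gi_zero q r
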